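/- **Setting.** A ball of radius $R>0$ centred at the origin, made of a homogeneous isotropic linearly elastic material with shear modulus $\mu_I>0$ and Poisson's ratio $\nu_I\in(-1,\tfrac12)$, is embedded in an infinite matrix with constants $\mu>0$, $\nu\in(-1,\tfrac12)$. Put $\lambda=\frac{2\mu\nu}{1-2\nu}$, $\lambda_I=\frac{2\mu_I\nu_I}{1-2\nu_I}$, $K_I=\frac23\mu_I\frac{1+\nu_I}{1-2\nu_I}$. The interface $r=R$ is a complete Steigmann–Ogden surface with real parameters $\sigma_0,\mu_0,\lambda_0,\chi_0,\zeta_0$, and the load at infinity is simple shear, $\sigma_{11}^\infty=-\sigma_{22}^\infty=\sigma_d$, all other $\sigma_{ij}^\infty=0$. A *solution* is a pair of displacement fields (in $|\mathbf x|\le R$ and in $|\mathbf x|\ge R$, smooth up to the interface) in equilibrium without body forces in each phase, equal on $r=R$, whose stress in the matrix tends to $\sigma^\infty$ as $|\mathbf x|\to\infty$, and whose tractions satisfy at $r=R$, $0<\theta<\pi$, in spherical coordinates (commas denote derivatives, $[\sigma]=\sigma^{inh}-\sigma^{mat}$) $$[\sigma_{rr}]=\tfrac{1}{r\sin\theta}\big[T_{\varphi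 r,\varphi}+T_{\theta r}\cos\theta+(T_{\theta r,\theta}-T_{\varphi\varphi}-T_{\theta\theta})\sin\theta\big]+\tfrac1{r^2\sin^2\theta}\big[M_{\varphi\varphi,\varphi\varphi}+(M_{\theta\varphi,\theta\varphi}+M_{\varphi\theta,\varphi\theta})\sin\theta+M_{\theta\theta,\theta\theta}\sin^2\theta+(M_{\varphi\theta,\varphi}+M_{\theta\varphi,\varphi})\cos\theta+(2M_{\theta\theta,\theta}-M_{\varphi\varphi,\theta})\cos\theta\sin\theta-(M_{\theta\theta}-M_{\varphi\varphi})\sin^2\theta\big],$$ $$[\sigma_{r\theta}]=\tfrac1{r\sin\theta}\big[T_{\varphi\theta,\varphi}+(T_{\theta\theta,\theta}+T_{\theta r})\sin\theta+(T_{\theta\theta}-T_{\varphi\varphi})\cos\theta\big]+\tfrac1{r^2\sin\theta}\big[M_{\varphi\theta,\varphi}+(M_{\theta\theta}-M_{\varphi\varphi})\cos\theta+M_{\theta\theta,\theta}\sin\theta\big],$$ $$[\sigma_{r\varphi}]=\tfrac1{r\sin\theta}\big[T_{\varphi\varphi,\varphi}+(T_{\theta\varphi,\theta}+T_{\varphi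 r})\sin\theta+(T_{\varphi\theta}+T_{\theta\varphi})\cos\theta\big]+\tfrac1{r^2\sin\theta}\big[M_{\varphi\varphi,\varphi}+(M_{\varphi\theta}+M_{\theta\varphi})\cos\theta+M_{\theta\varphi,\theta}\sin\theta\big],$$ where, with $e_\varphi=\frac{1}{r\sin\theta}(u_{\varphi,\varphi}+u_\theta\cos\theta+u_r\sin\theta)$ and $e_\theta=\frac1r(u_{\theta,\theta}+u_r)$, $T_{\theta\theta}=\sigma_0+(\lambda_0+\sigma_0)e_\varphi+(\lambda_0+2\mu_0)e_\theta$, $T_{\varphi\varphi}=\sigma_0+(\lambda_0+2\mu_0)e_\varphi+(\lambda_0+\sigma_0)e_\theta$, $T_{\varphi\theta}=\frac1{r\sin\theta}[\mu_0(u_{\theta,\varphi}-u_\varphi\cos\theta)+(\mu_0-\sigma_0)u_{\varphi,\theta}\sin\theta]$, $T_{\theta\varphi}=\frac1{r\sin\theta}[(\mu_0-\sigma_0)(u_{\theta,\varphi}-u_\varphi\cos\theta)+\mu_0u_{\varphi,\theta}\sin\theta]$, $T_{\theta r}=\frac{\sigma_0}{r}(u_{r,\theta}-u_\theta)$, $T_{\varphi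 r}=\frac{\sigma_0}{r\sin\theta}(u_{r,\varphi}-u_\varphi\sin\theta)$, $M_{\varphi\varphi}=(2\chi_0+\zeta_0)\kappa_{\varphi\varphi}+\zeta_0\kappa_{\theta\theta}$, $M_{\theta\theta}=\zeta_0\kappa_{\varphi\varphi}+(2\chi_0+\zeta_0)\kappa_{\theta\theta}$, $M_{\varphi\theta}=M_{\theta\varphi}=2\chi_0\kappa_{\varphi\theta}$, $\kappa_{\varphi\varphi}=-\frac1{r^2\sin^2\theta}[u_{r,\varphi\varphi}-u_{\varphi,\varphi}\sin\theta+(u_{r,\theta}-u_\theta)\cos\theta\sin\theta]$, $\kappa_{\theta\theta}=-\frac1{r^2}(u_{r,\theta\theta}-u_{\theta,\theta})$, $\kappa_{\varphi\theta}=-\frac1{2r^2\sin^2\theta}\big[(u_{r,\varphi\theta}-u_{\theta,\varphi})\sin\theta-(u_{r,\varphi}-u_\varphi\sin\theta)\cos\theta+\partial_\theta\big(\frac{u_{r,\varphi}}{\sin\theta}-u_\varphi\big)\sin^2\theta\big]$. The Gurtin–Murdoch problem is the same with all $M$ terms omitted. **Representations.** For constants $A_0,A_1,A_2,D_0,D_1,D_3,D_4$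 consider the fields with components $u_r=u^0(r)+U_r(r)\sin^2\theta\cos2\varphi$, $u_\theta=U_\theta(r)\sin\theta\cos\theta\cos2\varphi$, $u_\varphi=-U_\theta(r)\sin\theta\sin2\varphi$, where inside the inhomogeneity $u^0=-rA_0$, $U_r=A_1r-\frac{6\nu_I}{1-2\nu_I}A_2r^3$, $U_\theta=A_1r-\frac{7-4\nu_I}{1-2\nu_I}A_2r^3$, and inside the matrix $u^0=-D_0/r^2$, $U_r=D_1r+\frac{3D_3}{r^4}+\frac{5-4\nu}{1-2\nu}\frac{D_4}{r^2}$, $U_\theta=D_1r-\frac{2D_3}{r^4}+\frac{2D_4}{r^2}$. Let $\gamma=(5\chi_0+3\zeta_0)/R^3$ and $\eta_0=(2\mu_0+2\lambda_0+\sigma_0)/R$. **(i) Traction jumps.** For displacements of this form on the sphere of radius $r>0$, the right-hand sides of the three interface conditions are, respectively, $$-\tfrac{2\sigma_0}{r}-\tfrac{2(2\mu_0+2\lambda_0+\sigma_0)}{r^2}u^0+\Big[\tfrac1{r^2}\big(6(\lambda_0+\mu_0+\sigma_0)U_\theta-4(\mu_0+\lambda_0+2\sigma_0)U_r\big)-6\gamma\tfrac{R^3}{r^4}(2U_r-U_\theta)\Big]\sin^2\theta\cos2\varphi,$$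 $$\Big[\tfrac1{r^2}\big(-(3\lambda_0+5\mu_0+\sigma_0)U_\theta+2(\mu_0+\lambda_0+\sigma_0)U_r\big)+\gamma\tfrac{R^3}{r^4}(2U_r-U_\theta)\Big]\sin2\theta\cos2\varphi,$$ $$\Big[\tfrac2{r^2}\big((3\lambda_0+5\mu_0+\sigma_0)U_\theta-2(\mu_0+\lambda_0+\sigma_0)U_r\big)-2\gamma\tfrac{R^3}{r^4}(2U_r-U_\theta)\Big]\sin\theta\sin2\varphi;$$ hence the traction jumps at $r=R$ of every solution of this form are given by these expressions. **(ii) Linear system.** The fields solve the Steigmann–Ogden problem if and only if $D_1=\sigma_d/(2\mu)$, $D_0=R^3A_0$, $(4\mu+3K_I+2\eta_0)A_0=2\sigma_0/R$, and $$A_1R-3\tfrac{\lambda_I}{\mu_I}A_2R^3-3D_3R^{-4}-\tfrac{3\lambda+5\mu}{\mu}D_4R^{-2}=D_1R,\qquad A_1R-\tfrac{5\lambda_I+7\mu_I}{\mu_I}A_2R^3+2D_3R^{-4}-2D_4R^{-2}=D_1R,$$ $$C_{31}A_1R+C_{32}A_2R^3-24\mu D_3R^{-4}-(18\lambda+20\mu)D_4R^{-2}=-2\mu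 D_1R,$$ $$C_{41}A_1R+C_{42}A_2R^3+8\mu D_3R^{-4}+(3\lambda+2\mu)D_4R^{-2}=-\mu D_1R,$$ with $C_{31}=-2\mu_I+\frac2R(\lambda_0+\mu_0-\sigma_0)-6\gamma$, $C_{32}=-3\lambda_I-\frac6R(\lambda_0+\mu_0)\frac{3\lambda_I+7\mu_I}{\mu_I}-\frac6R\sigma_0\frac{\lambda_I+7\mu_I}{\mu_I}+6\gamma\frac{\lambda_I-7\mu_I}{\mu_I}$, $C_{41}=-\mu_I-\frac1R(3\mu_0+\lambda_0-\sigma_0)+\gamma$, $C_{42}=8\lambda_I+7\mu_I+\frac{\mu_0}R\frac{19\lambda_I+35\mu_I}{\mu_I}+3\frac{\lambda_0}R\frac{3\lambda_I+7\mu_I}{\mu_I}-\frac{\sigma_0}R\frac{\lambda_I-7\mu_I}{\mu_I}-\gamma\frac{\lambda_I-7\mu_I}{\mu_I}$. **(iii) Closed form.** Let $E_{11}=1-\frac{(3\lambda+10\mu)C_{31}+(18\lambda+44\mu)C_{41}}{4\mu(9\lambda+14\mu)}$, $E_{12}=-\frac{(3\lambda+10\mu)C_{32}+(18\lambda+44\mu)C_{42}}{4\mu(9\lambda+14\mu)}-\frac{5\lambda_I+7\mu_I}{\mu_I}$,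 $E_{21}=1-\frac{(15\lambda+34\mu)C_{31}+6(3\lambda+10\mu)C_{41}}{8\mu(9\lambda+14\mu)}$, $E_{22}=-\frac{3\lambda_I}{\mu_I}-\frac{(15\lambda+34\mu)C_{32}+6(3\lambda+10\mu)C_{42}}{8\mu(9\lambda+14\mu)}$, $F=\frac{15(\lambda+2\mu)}{9\lambda+14\mu}$, $\Delta=E_{11}E_{22}-E_{12}E_{21}$. If $\Delta\ne0$, the four equations for $A_1,A_2,D_3,D_4$ hold if and only if $A_1=a_1D_1$, $A_2=a_2D_1$, $D_3=d_3D_1$, $D_4=d_4D_1$, where $$a_1=\frac{F(E_{22}-E_{12})}{\Delta},\qquad a_2=\frac{F(E_{11}-E_{21})}{R^2\Delta},$$ $$d_3=-\frac{a_1\big((3\lambda+2\mu)C_{31}+(18\lambda+20\mu)C_{41}\big)R^5+a_2\big((3\lambda+2\mu)C_{32}+(18\lambda+20\mu)C_{42}\big)R^7+24\mu(\mu+\lambda)R^5}{8\mu(9\lambda+14\mu)},$$ $$d_4=\frac{a_1(C_{31}+3C_{41})R^3+a_2(C_{32}+3C_{42})R^5+5\mu R^3}{9\lambda+14\mu}.$$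 If moreover $4\mu+3K_I+2\eta_0\neq0$, then the fields solve the problem if and only if the seven constants have these values (with $D_1=\sigma_d/(2\mu)$, $A_0=D_0/R^3=\frac{2\sigma_0/R}{4\mu+3K_I+2\eta_0}$), and then $u_r=U_r(r)\sin^2\theta\cos2\varphi+A\sigma_0(r/R)^p$ with $A=-\frac{2}{4\mu+3K_I+2\eta_0}$, where $p=1$ inside the inhomogeneity and $p=-2$ in the matrix. **(iv) Gurtin–Murdoch case.** If $\gamma=0$, the fields solve the Steigmann–Ogden problem if and only if they solve the Gurtin–Murdoch problem. This holds if and only if $D_1=\sigma_d/(2\mu)$ and the Gurtin–Murdoch system $$D_0/R^3=A_0,\qquad \tfrac{2}{R^3}D_0=-\tfrac{\mu_I}{\mu}\tfrac{1+\nu_I}{1-2\nu_I}A_0-f_0,$$ $$D_1-\tfrac2{R^5}D_3+\tfrac2{R^3}D_4=V_\theta,\qquad D_1+\tfrac3{R^5}D_3+\tfrac1{R^3}\tfrac{5-4\nu}{1-2\nu}D_4=V_r,$$ $$D_1+\tfrac2{R^3}\Big(\tfrac4{R^2}D_3+\tfrac{1+\nu}{1-2\nu}D_4\Big)=\tfrac{\mu_I}\mu\Big(A_1-R^2\tfrac{7+2\nu_I}{1-2\nu_I}A_2\Big)-6f_1,$$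 $$D_1+\tfrac2{R^3}\Big(-\tfrac6{R^2}D_3+\tfrac{\nu-5}{1-2\nu}D_4\Big)=\tfrac{\mu_I}\mu\Big(A_1+R^2\tfrac{3\nu_I}{1-2\nu_I}A_2\Big)-3f_2$$ holds, where $V_\theta=A_1-R^2\frac{7-4\nu_I}{1-2\nu_I}A_2$, $V_r=A_1-R^2\frac{6\nu_I}{1-2\nu_I}A_2$, $f_0=-\frac{\sigma_0}{\mu R}+\frac{\eta_0}{\mu}A_0$, $f_1=\frac{(\mu_0-\sigma_0)-3(\lambda_0+2\mu_0)}{6\mu R}V_\theta+\frac{\lambda_0+\mu_0+\sigma_0}{3\mu R}V_r$, $f_2=\frac{\lambda_0+\mu_0+\sigma_0}{\mu R}V_\theta-2\frac{\lambda_0+\mu_0+2\sigma_0}{3\mu R}V_r$. For $\gamma=0$ this system is equivalent to $D_0=R^3A_0$, $(4\mu+3K_I+2\eta_0)A_0=2\sigma_0/R$ and the four equations in (ii); and if in addition $\Delta\ne0$ and $4\mu+3K_I+2\eta_0\ne0$, the fields solve the Gurtin–Murdoch problem if and only if the constants have the values in (iii) (with $\gamma=0$). -/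

import Mathlib

open Real Set Filter Topology
open scoped ContDiff

noncomputable section

namespace SphericalInhomogeneity

/-! ### Data -/

/-- Isotropic linearly elastic material: shear modulus `μ`, Poisson's ratio `ν`. -/
structure Material where
  μ : ℝ
  ν : ℝ

namespace Material

/-- Lamé's first parameter. -/
def lam (m : Material) : ℝ := 2 * m.μ * m.ν / (1 - 2 * m.ν)

/-- Three-dimensional bulk modulus. -/
def bulk (m : Material) : ℝ := 2 / 3 * m.μ * (1 + m.ν) / (1 - 2 * m.ν)

/-- The admissible range of the elastic constants. -/
def Admissible (m : Material) : Prop := 0 < m.μ ∧ -1 < m.ν ∧ m.ν < 1 / 2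

end Material

/-- Parameters of a Steigmann–Ogden interface: surface tension `σ₀`, surface Lamé parameters
`μ₀`, `lam₀`, bending stiffness parameters `χ₀`, `ζ₀`. -/
structure Interface where
  σ₀ : ℝ
  μ₀ : ℝ
  lam₀ : ℝ
  χ₀ : ℝ
  ζ₀ : ℝ

/-- The combined bending parameter `γ = (5 χ₀ + 3 ζ₀) / R³`. -/
def Interface.gam (S : Interface) (R : ℝ) : ℝ := (5 * S.χ₀ + 3 * S.ζ₀) / R ^ 3

/-- `η₀ = (2 μ₀ + 2 λ₀ + σ₀) / R`. -/
def Interface.eta (S : Interface) (R : ℝ) : ℝ := (2 * S.μ₀ + 2 * S.lam₀ + S.σ₀) / R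

/-! ### Bulk elasticity in Cartesian coordinates -/

abbrev E3 : Type := EuclideanSpace ℝ (Fin 3)

/-- Partial derivative `∂f/∂x_j` at `x`. -/
def partialDeriv (j : Fin 3) (f : E3 → ℝ) (x : E3) : ℝ :=
  fderiv ℝ f x (EuclideanSpace.single j 1)

/-- Hooke's law: `σ_ij = λ (div u) δ_ij + μ (∂_j u_i + ∂_i u_j)`. -/
def stress (m : Material) (u : E3 → E3) (x : E3) : Matrix (Fin 3) (Fin 3) ℝ := fun i j =>
  m.lam * (∑ k, partialDeriv k (fun y => u y k) x) * (if i = j then 1 else 0)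
    + m.μ * (partialDeriv j (fun y => u y i) x + partialDeriv i (fun y => u y j) x)

/-- Equilibrium without body forces at `x`: `∑_j ∂_j σ_ij = 0`. -/
def EquilibriumAt (m : Material) (u : E3 → E3) (x : E3) : Prop :=
  ∀ i, ∑ j, partialDeriv j (fun y => stress m u y i j) x = 0

/-- The simple shear far-field stress: `σ₁₁ = -σ₂₂ = σd`, all other components zero. -/
def shearStress (σd : ℝ) : Matrix (Fin 3) (Fin 3) ℝ := Matrix.diagonal ![σd, -σd, 0]

/-! ### Spherical coordinates -/

def sphPoint (r θ φ : ℝ) : E3 := !₂[r * (sin θ * cos φ), r * (sin θ * sin φ), r * cos θ]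

def eR (θ φ : ℝ) : E3 := !₂[sin θ * cos φ, sin θ * sin φ, cos θ]

def eTheta (θ φ : ℝ) : E3 := !₂[cos θ * cos φ, cos θ * sin φ, -sin θ]

def ePhi (φ : ℝ) : E3 := !₂[-sin φ, cos φ, 0]

/-- Spherical components, as functions of `(θ, φ)`, of a vector field on a sphere. -/
structure SphComponents where
  r : ℝ → ℝ → ℝ
  θ : ℝ → ℝ → ℝ
  φ : ℝ → ℝ → ℝ

/-- The spherical components of `u` on the sphere of radius `r`. -/
def sphTrace (u : E3 → E3) (r : ℝ) : SphComponents where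
  r θ φ := inner ℝ (u (sphPoint r θ φ)) (eR θ φ)
  θ θ φ := inner ℝ (u (sphPoint r θ φ)) (eTheta θ φ)
  φ θ φ := inner ℝ (u (sphPoint r θ φ)) (ePhi φ)

/-- The vector field on `ℝ³` whose spherical components on the sphere of radius `r`
are `c r`. -/
def sphField (c : ℝ → SphComponents) (x : E3) : E3 :=
  let r := ‖x‖
  let θ := arccos (x 2 / ‖x‖)
  let φ := Complex.arg ⟨x 0, x 1⟩
  (c r).r θ φ • eR θ φ + (c r).θ θ φ • eTheta θ φ + (c r).φ θ φ • ePhi φ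

/-- The spherical components `σ_rr`, `σ_rθ`, `σ_rφ`, on the sphere of radius `r`, of a field of
stress tensors. -/
def sphTraction (s : E3 → Matrix (Fin 3) (Fin 3) ℝ) (r : ℝ) : SphComponents where
  r θ φ := ∑ i, ∑ j, eR θ φ i * s (sphPoint r θ φ) i j * eR θ φ j
  θ θ φ := ∑ i, ∑ j, eTheta θ φ i * s (sphPoint r θ φ) i j * eR θ φ j
  φ θ φ := ∑ i, ∑ j, ePhi φ i * s (sphPoint r θ φ) i j * eR θ φ j

/-- `∂/∂θ` and `∂/∂φ` of functions of `(θ, φ)`. -/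
def dTheta (f : ℝ → ℝ → ℝ) (θ φ : ℝ) : ℝ := deriv (fun t => f t φ) θ

def dPhi (f : ℝ → ℝ → ℝ) (θ φ : ℝ) : ℝ := deriv (fun t => f θ t) φ

/-! ### Surface stress, surface couple stress and traction jumps

In this part `u` gives the spherical components of the displacements on the sphere of
radius `r`. -/

section Surface

variable (S : Interface) (r : ℝ) (u : SphComponents)

def Ttt (θ φ : ℝ) : ℝ :=
  S.σ₀ + (S.lam₀ + S.σ₀) / (r * sin θ) * (dPhi u.φ θ φ + u.θ θ φ * cos θ + u.r θ φ * sin θ)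
    + (S.lam₀ + 2 * S.μ₀) / r * (dTheta u.θ θ φ + u.r θ φ)

def Tpp (θ φ : ℝ) : ℝ :=
  S.σ₀ + (S.lam₀ + 2 * S.μ₀) / (r * sin θ) * (dPhi u.φ θ φ + u.θ θ φ * cos θ + u.r θ φ * sin θ)
    + (S.lam₀ + S.σ₀) / r * (dTheta u.θ θ φ + u.r θ φ)

def Tpt (θ φ : ℝ) : ℝ :=
  1 / (r * sin θ) * (S.μ₀ * (dPhi u.θ θ φ - u.φ θ φ * cos θ)
    + (S.μ₀ - S.σ₀) * dTheta u.φ θ φ * sin θ)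

def Ttp (θ φ : ℝ) : ℝ :=
  1 / (r * sin θ) * ((S.μ₀ - S.σ₀) * (dPhi u.θ θ φ - u.φ θ φ * cos θ)
    + S.μ₀ * dTheta u.φ θ φ * sin θ)

def Ttr (θ φ : ℝ) : ℝ := S.σ₀ / r * (dTheta u.r θ φ - u.θ θ φ)

def Tpr (θ φ : ℝ) : ℝ := S.σ₀ / (r * sin θ) * (dPhi u.r θ φ - u.φ θ φ * sin θ)

/-- Changes of curvature. -/
def kpp (θ φ : ℝ) : ℝ :=
  -(1 / (r ^ 2 * sin θ ^ 2)) * (dPhi (dPhi u.r) θ φ - dPhi u.φ θ φ * sin θ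
    + (dTheta u.r θ φ - u.θ θ φ) * cos θ * sin θ)

def kpt (θ φ : ℝ) : ℝ :=
  -(1 / (2 * r ^ 2 * sin θ ^ 2)) * ((dTheta (dPhi u.r) θ φ - dPhi u.θ θ φ) * sin θ
    - (dPhi u.r θ φ - u.φ θ φ * sin θ) * cos θ
    + dTheta (fun t p => dPhi u.r t p / sin t - u.φ t p) θ φ * sin θ ^ 2)

def ktt (θ φ : ℝ) : ℝ :=
  -(1 / r ^ 2) * (dTheta (dTheta u.r) θ φ - dTheta u.θ θ φ)

/-- Surface couple stresses. -/
def Mpp (θ φ : ℝ) : ℝ := (2 * S.χ₀ + S.ζ₀) * kpp r u θ φ + S.ζ₀ * ktt r u θ φ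

def Mpt (θ φ : ℝ) : ℝ := 2 * S.χ₀ * kpt r u θ φ

def Mtp (θ φ : ℝ) : ℝ := Mpt S r u θ φ

def Mtt (θ φ : ℝ) : ℝ := S.ζ₀ * kpp r u θ φ + (2 * S.χ₀ + S.ζ₀) * ktt r u θ φ

/-- Jump of the tractions (inhomogeneity minus matrix) prescribed by the complete
Gurtin–Murdoch model (this model ignores `χ₀` and `ζ₀`). -/
def gurtinMurdochJump : SphComponents where
  r θ φ := 1 / (r * sin θ) * (dPhi (Tpr S r u) θ φ + Ttr S r u θ φ * cos θ
    + (dTheta (Ttr S r u) θ φ - Tpp S r u θ φ - Ttt S r u θ φ) * sin θ)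
  θ θ φ := 1 / (r * sin θ) * (dPhi (Tpt S r u) θ φ
    + (dTheta (Ttt S r u) θ φ + Ttr S r u θ φ) * sin θ
    + (Ttt S r u θ φ - Tpp S r u θ φ) * cos θ)
  φ θ φ := 1 / (r * sin θ) * (dPhi (Tpp S r u) θ φ
    + (dTheta (Ttp S r u) θ φ + Tpr S r u θ φ) * sin θ
    + (Tpt S r u θ φ + Ttp S r u θ φ) * cos θ)

/-- Jump of the tractions (inhomogeneity minus matrix) prescribed by the complete
Steigmann–Ogden model. -/
def steigmannOgdenJump : SphComponents where
  r θ φ := (gurtinMurdochJump S r u).r θ φ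
    + 1 / (r ^ 2 * sin θ ^ 2) * (dPhi (dPhi (Mpp S r u)) θ φ
      + (dPhi (dTheta (Mtp S r u)) θ φ + dTheta (dPhi (Mpt S r u)) θ φ) * sin θ
      + dTheta (dTheta (Mtt S r u)) θ φ * sin θ ^ 2
      + (dPhi (Mpt S r u) θ φ + dPhi (Mtp S r u) θ φ) * cos θ
      + (2 * dTheta (Mtt S r u) θ φ - dTheta (Mpp S r u) θ φ) * cos θ * sin θ
      - (Mtt S r u θ φ - Mpp S r u θ φ) * sin θ ^ 2)
  θ θ φ := (gurtinMurdochJump S r u).θ θ φ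
    + 1 / (r ^ 2 * sin θ) * (dPhi (Mpt S r u) θ φ
      + (Mtt S r u θ φ - Mpp S r u θ φ) * cos θ
      + dTheta (Mtt S r u) θ φ * sin θ)
  φ θ φ := (gurtinMurdochJump S r u).φ θ φ
    + 1 / (r ^ 2 * sin θ) * (dPhi (Mpp S r u) θ φ
      + (Mpt S r u θ φ + Mtp S r u θ φ) * cos θ
      + dTheta (Mtp S r u) θ φ * sin θ)

end Surface

/-! ### The inhomogeneity problem -/

/-- `uI`, `uM` (displacements in the ball `‖x‖ ≤ R` and in its complement, both smooth up to the
interface) solve the problem of a spherical inhomogeneity of material `mI` in an infinite matrix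
of material `m` under the simple shear load `σd` at infinity: equilibrium in both phases,
continuity of the displacements, the jump of tractions prescribed by `jump` (which takes the
radius of the sphere and the displacements on it), and the far-field condition. -/
structure IsSolution (R : ℝ) (m mI : Material) (σd : ℝ)
    (jump : ℝ → SphComponents → SphComponents) (uI uM : E3 → E3) : Prop where
  smooth_inh : ∀ x : E3, ‖x‖ ≤ R → ContDiffAt ℝ ∞ uI x
  smooth_mat : ∀ x : E3, R ≤ ‖x‖ → ContDiffAt ℝ ∞ uM x
  equilibrium_inh : ∀ x : E3, ‖x‖ < R → EquilibriumAt mI uI x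
  equilibrium_mat : ∀ x : E3, R < ‖x‖ → EquilibriumAt m uM x
  continuity : ∀ x : E3, ‖x‖ = R → uI x = uM x
  jump_r : ∀ θ ∈ Ioo 0 π, ∀ φ : ℝ,
    (sphTraction (stress mI uI) R).r θ φ - (sphTraction (stress m uM) R).r θ φ
      = (jump R (sphTrace uI R)).r θ φ
  jump_θ : ∀ θ ∈ Ioo 0 π, ∀ φ : ℝ,
    (sphTraction (stress mI uI) R).θ θ φ - (sphTraction (stress m uM) R).θ θ φ
      = (jump R (sphTrace uI R)).θ θ φ
  jump_φ : ∀ θ ∈ Ioo 0 π, ∀ φ : ℝ,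
    (sphTraction (stress mI uI) R).φ θ φ - (sphTraction (stress m uM) R).φ θ φ
      = (jump R (sphTrace uI R)).φ θ φ
  far_field : Tendsto (stress m uM) (Bornology.cobounded E3) (𝓝 (shearStress σd))

/-! ### The modified Christensen–Lo representations -/

@[ext]
structure Coeffs where
  A0 : ℝ
  A1 : ℝ
  A2 : ℝ
  D0 : ℝ
  D1 : ℝ
  D3 : ℝ
  D4 : ℝ

def UrInh (mI : Material) (c : Coeffs) (r : ℝ) : ℝ :=
  c.A1 * r - 6 * mI.ν / (1 - 2 * mI.ν) * c.A2 * r ^ 3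

def UtInh (mI : Material) (c : Coeffs) (r : ℝ) : ℝ :=
  c.A1 * r - (7 - 4 * mI.ν) / (1 - 2 * mI.ν) * c.A2 * r ^ 3

def UrMat (m : Material) (c : Coeffs) (r : ℝ) : ℝ :=
  c.D1 * r + 3 * c.D3 / r ^ 4 + (5 - 4 * m.ν) / (1 - 2 * m.ν) * (c.D4 / r ^ 2)

def UtMat (c : Coeffs) (r : ℝ) : ℝ :=
  c.D1 * r - 2 * c.D3 / r ^ 4 + 2 * (c.D4 / r ^ 2)

/-- The angular shape shared by both representations: an isotropic radial part `u0` plus the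
simple-shear harmonic with amplitudes `Ur`, `Ut`. -/
def shearShape (u0 Ur Ut : ℝ) : SphComponents where
  r θ φ := u0 + Ur * sin θ ^ 2 * cos (2 * φ)
  θ θ φ := Ut * sin θ * cos θ * cos (2 * φ)
  φ θ φ := -(Ut * sin θ * sin (2 * φ))

/-- Displacements inside the inhomogeneity. -/
def uInh (mI : Material) (c : Coeffs) : E3 → E3 :=
  sphField fun r => shearShape (-(r * c.A0)) (UrInh mI c r) (UtInh mI c r)

/-- Displacements inside the matrix. -/
def uMat (m : Material) (c : Coeffs) : E3 → E3 :=
  sphField fun r => shearShape (-(1 / r ^ 2 * c.D0)) (UrMat m c r) (UtMat c r)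

/-- The explicit form of the traction jumps on the sphere of radius `r`. -/
def explicitJump (S : Interface) (R r u0 Ur Ut : ℝ) : SphComponents where
  r θ φ := -(2 * S.σ₀ / r) - 2 * (2 * S.μ₀ + 2 * S.lam₀ + S.σ₀) * u0 / r ^ 2
    + (1 / r ^ 2 * (6 * (S.lam₀ + S.μ₀ + S.σ₀) * Ut - 4 * (S.μ₀ + S.lam₀ + 2 * S.σ₀) * Ur)
      - 6 * S.gam R * (R ^ 3 / r ^ 4) * (2 * Ur - Ut)) * sin θ ^ 2 * cos (2 * φ)
  θ θ φ := (1 / r ^ 2 * (-(3 * S.lam₀ + 5 * S.μ₀ + S.σ₀) * Ut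
        + 2 * (S.μ₀ + S.lam₀ + S.σ₀) * Ur)
      + S.gam R * (R ^ 3 / r ^ 4) * (2 * Ur - Ut)) * sin (2 * θ) * cos (2 * φ)
  φ θ φ := (2 / r ^ 2 * ((3 * S.lam₀ + 5 * S.μ₀ + S.σ₀) * Ut
        - 2 * (S.μ₀ + S.lam₀ + S.σ₀) * Ur)
      - 2 * S.gam R * (R ^ 3 / r ^ 4) * (2 * Ur - Ut)) * sin θ * sin (2 * φ)

/-! ### The linear system for the shear coefficients and its solution -/

section System

variable (R : ℝ) (m mI : Material) (S : Interface)

def C31 : ℝ := -2 * mI.μ + 2 / R * (S.lam₀ + S.μ₀ - S.σ₀) - 6 * S.gam R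

def C32 : ℝ :=
  -3 * mI.lam - 6 / R * (S.lam₀ + S.μ₀) * ((3 * mI.lam + 7 * mI.μ) / mI.μ)
    - 6 / R * S.σ₀ * ((mI.lam + 7 * mI.μ) / mI.μ)
    + 6 * S.gam R * ((mI.lam - 7 * mI.μ) / mI.μ)

def C41 : ℝ := -mI.μ - 1 / R * (3 * S.μ₀ + S.lam₀ - S.σ₀) + S.gam R

def C42 : ℝ :=
  8 * mI.lam + 7 * mI.μ + S.μ₀ / R * ((19 * mI.lam + 35 * mI.μ) / mI.μ)
    + 3 * (S.lam₀ / R) * ((3 * mI.lam + 7 * mI.μ) / mI.μ)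
    - S.σ₀ / R * ((mI.lam - 7 * mI.μ) / mI.μ)
    - S.gam R * ((mI.lam - 7 * mI.μ) / mI.μ)

/-- The linear system for `A1`, `A2`, `D3`, `D4`. -/
def ShearSystem (c : Coeffs) : Prop :=
  c.A1 * R - 3 * (mI.lam / mI.μ) * c.A2 * R ^ 3 - 3 * c.D3 / R ^ 4
      - (3 * m.lam + 5 * m.μ) / m.μ * (c.D4 / R ^ 2) = c.D1 * R ∧
  c.A1 * R - (5 * mI.lam + 7 * mI.μ) / mI.μ * c.A2 * R ^ 3 + 2 * c.D3 / R ^ 4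
      - 2 * (c.D4 / R ^ 2) = c.D1 * R ∧
  C31 R mI S * c.A1 * R + C32 R mI S * c.A2 * R ^ 3 - 24 * m.μ * (c.D3 / R ^ 4)
      - (18 * m.lam + 20 * m.μ) * (c.D4 / R ^ 2) = -2 * m.μ * c.D1 * R ∧
  C41 R mI S * c.A1 * R + C42 R mI S * c.A2 * R ^ 3 + 8 * m.μ * (c.D3 / R ^ 4)
      + (3 * m.lam + 2 * m.μ) * (c.D4 / R ^ 2) = -m.μ * c.D1 * R

def E11 : ℝ :=
  1 - ((3 * m.lam + 10 * m.μ) * C31 R mI S + (18 * m.lam + 44 * m.μ) * C41 R mI S)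
    / (4 * m.μ * (9 * m.lam + 14 * m.μ))

def E12 : ℝ :=
  -(((3 * m.lam + 10 * m.μ) * C32 R mI S + (18 * m.lam + 44 * m.μ) * C42 R mI S)
    / (4 * m.μ * (9 * m.lam + 14 * m.μ))) - (5 * mI.lam + 7 * mI.μ) / mI.μ

def E21 : ℝ :=
  1 - ((15 * m.lam + 34 * m.μ) * C31 R mI S + 6 * (3 * m.lam + 10 * m.μ) * C41 R mI S)
    / (8 * m.μ * (9 * m.lam + 14 * m.μ))

def E22 : ℝ :=
  -(3 * mI.lam / mI.μ)
    - ((15 * m.lam + 34 * m.μ) * C32 R mI S + 6 * (3 * m.lam + 10 * m.μ) * C42 R mI S)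
      / (8 * m.μ * (9 * m.lam + 14 * m.μ))

def coeffF : ℝ := 15 * (m.lam + 2 * m.μ) / (9 * m.lam + 14 * m.μ)

/-- The denominator `E11 E22 - E12 E21`. -/
def detE : ℝ := E11 R m mI S * E22 R m mI S - E12 R m mI S * E21 R m mI S

/-- The closed forms of the ratios `A1/D1`, `A2/D1`, `D3/D1`, `D4/D1`. -/
def ratioA1 : ℝ := coeffF m * (E22 R m mI S - E12 R m mI S) / detE R m mI S

def ratioA2 : ℝ :=
  coeffF m * (E11 R m mI S - E21 R m mI S) / R ^ 2 / detE R m mI S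

def ratioD3 : ℝ :=
  -(ratioA1 R m mI S
        * ((3 * m.lam + 2 * m.μ) * C31 R mI S + (18 * m.lam + 20 * m.μ) * C41 R mI S) * R ^ 5
      + ratioA2 R m mI S
        * ((3 * m.lam + 2 * m.μ) * C32 R mI S + (18 * m.lam + 20 * m.μ) * C42 R mI S) * R ^ 7
      + 24 * m.μ * (m.μ + m.lam) * R ^ 5)
    / (8 * m.μ * (9 * m.lam + 14 * m.μ))

def ratioD4 : ℝ :=
  (ratioA1 R m mI S * (C31 R mI S + 3 * C41 R mI S) * R ^ 3
      + ratioA2 R m mI S * (C32 R mI S + 3 * C42 R mI S) * R ^ 5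
      + 5 * m.μ * R ^ 3)
    / (9 * m.lam + 14 * m.μ)

/-- The denominator in the coefficients of the isotropic part. -/
def isoDenom : ℝ := 4 * m.μ + 3 * mI.bulk + 2 * S.eta R

/-- All coefficients of the solution in closed form. -/
def closedCoeffs (σd : ℝ) : Coeffs where
  A0 := 2 * S.σ₀ / R / isoDenom R m mI S
  A1 := ratioA1 R m mI S * (σd / (2 * m.μ))
  A2 := ratioA2 R m mI S * (σd / (2 * m.μ))
  D0 := R ^ 3 * (2 * S.σ₀ / R / isoDenom R m mI S)
  D1 := σd / (2 * m.μ)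
  D3 := ratioD3 R m mI S * (σd / (2 * m.μ))
  D4 := ratioD4 R m mI S * (σd / (2 * m.μ))

/-- The Gurtin–Murdoch right-hand sides `f0`, `f1`, `f2`. -/
def gmF0 (c : Coeffs) : ℝ := -(S.σ₀ / (m.μ * R)) + S.eta R / m.μ * c.A0

def gmF1 (c : Coeffs) : ℝ :=
  ((S.μ₀ - S.σ₀) - 3 * (S.lam₀ + 2 * S.μ₀)) / (6 * m.μ * R)
      * (c.A1 - R ^ 2 * ((7 - 4 * mI.ν) / (1 - 2 * mI.ν)) * c.A2)
    + (S.lam₀ + S.μ₀ + S.σ₀) / (3 * m.μ * R)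
      * (c.A1 - R ^ 2 * (6 * mI.ν / (1 - 2 * mI.ν)) * c.A2)

def gmF2 (c : Coeffs) : ℝ :=
  (S.lam₀ + S.μ₀ + S.σ₀) / (m.μ * R)
      * (c.A1 - R ^ 2 * ((7 - 4 * mI.ν) / (1 - 2 * mI.ν)) * c.A2)
    - 2 * ((S.lam₀ + S.μ₀ + 2 * S.σ₀) / (3 * m.μ * R))
      * (c.A1 - R ^ 2 * (6 * mI.ν / (1 - 2 * mI.ν)) * c.A2)

/-- The linear system of the Gurtin–Murdoch problem under simple shear: continuity of
displacements and the interface conditions. -/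
def GurtinMurdochSystem (c : Coeffs) : Prop :=
  1 / R ^ 3 * c.D0 = c.A0 ∧
  c.D1 - 2 / R ^ 5 * c.D3 + 2 / R ^ 3 * c.D4
    = c.A1 - R ^ 2 * ((7 - 4 * mI.ν) / (1 - 2 * mI.ν)) * c.A2 ∧
  c.D1 + 3 / R ^ 5 * c.D3 + 1 / R ^ 3 * ((5 - 4 * m.ν) / (1 - 2 * m.ν)) * c.D4
    = c.A1 - R ^ 2 * (6 * mI.ν / (1 - 2 * mI.ν)) * c.A2 ∧
  2 / R ^ 3 * c.D0
    = -(mI.μ / m.μ * ((1 + mI.ν) / (1 - 2 * mI.ν)) * c.A0) - gmF0 R m S c ∧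
  c.D1 + 2 / R ^ 3 * (4 / R ^ 2 * c.D3 + (1 + m.ν) / (1 - 2 * m.ν) * c.D4)
    = mI.μ / m.μ * (c.A1 - R ^ 2 * ((7 + 2 * mI.ν) / (1 - 2 * mI.ν)) * c.A2)
      - 6 * gmF1 R m mI S c ∧
  c.D1 + 2 / R ^ 3 * (-(6 / R ^ 2) * c.D3 + (m.ν - 5) / (1 - 2 * m.ν) * c.D4)
    = mI.μ / m.μ * (c.A1 + R ^ 2 * (3 * mI.ν / (1 - 2 * mI.ν)) * c.A2)
      - 3 * gmF2 R m mI S c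

end System

end SphericalInhomogeneity

end

open SphericalInhomogeneity

noncomputable section

namespace SphericalInhomogeneity

/-! ### Surface derivatives of the simple-shear shape -/

/-! Let Y = sin²θ cos 2φ, a spherical harmonic of degree two. The displacements considered have
radial part u0 + Ur Y and tangential part (Ut/2)∇Y, with ∇ the gradient on the unit sphere. Stress,
traction and both surface operators preserve this shape, so every condition of the problem becomes a
comparison of three amplitudes: isotropic, radial and tangential.

On the interface this is direct differentiation away from the poles, ending in
`steigmannOgdenJump_eq_explicitJump`. Bending sees only ∇u_r - u_tan = (Ur - Ut/2)∇Y, whence the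
factor 2Ur - Ut, and χ₀, ζ₀ enter only through 5χ₀ + 3ζ₀.

In the bulk, the definition by `arccos` and `arg` is replaced by the Cartesian formula α∇P + (βP +
δ)x, where P = x₀² - x₁² = r²Y and α, β, δ depend on ‖x‖². Its stress is explicit
(`Profile.stress_field`), equilibrium reduces to three scalar identities (`Profile.Balanced`), and
the tractions again have the shape above (`Profile.sphTraction_field`). The profiles of the two
phases satisfy these identities for all values of the constants.

Hence only the far field, continuity and the jumps constrain the constants
(`isSolution_iff_profile`). The far field fixes D1; A0 and D0 decouple; four equations remain for
A1, A2, D3, D4. The two traction equations can be solved for D3 and D4, their determinant being a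
nonzero multiple of μ(9λ + 14μ); substitution into continuity leaves a 2×2 system with determinant
`detE`, solved by Cramer's rule. For γ = 0 the Gurtin–Murdoch system consists of nonzero multiples
of the same equations, once D0 = R³A0 is used in the isotropic one. -/

/-- The closed forms below hold only off the poles; as sin t ≠ 0 is an open condition, they may
still be differentiated in θ. -/
lemma dTheta_congr {f g : ℝ → ℝ → ℝ} {θ φ : ℝ} (hθ : sin θ ≠ 0)
    (h : ∀ t p, sin t ≠ 0 → f t p = g t p) : dTheta f θ φ = dTheta g θ φ := by
  refine Filter.EventuallyEq.deriv_eq ?_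
  filter_upwards [continuous_sin.continuousAt.eventually_ne hθ] with t ht using h t φ ht

lemma dPhi_congr {f g : ℝ → ℝ → ℝ} {θ φ : ℝ} (hθ : sin θ ≠ 0)
    (h : ∀ t p, sin t ≠ 0 → f t p = g t p) : dPhi f θ φ = dPhi g θ φ := by
  have : (fun t => f θ t) = fun t => g θ t := funext fun p => h θ p hθ
  simp only [dPhi, this]

lemma hasDerivAt_cos_two_mul (φ : ℝ) :
    HasDerivAt (fun p => cos (2 * p)) (-(2 * sin (2 * φ))) φ := by
  simpa [mul_comm] using ((hasDerivAt_id φ).const_mul 2).cos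

lemma hasDerivAt_sin_two_mul (φ : ℝ) :
    HasDerivAt (fun p => sin (2 * p)) (2 * cos (2 * φ)) φ := by
  simpa [mul_comm] using ((hasDerivAt_id φ).const_mul 2).sin

lemma dPhi_add_mul_cos (a b : ℝ → ℝ) (θ φ : ℝ) :
    dPhi (fun t p => a t + b t * cos (2 * p)) θ φ = -(2 * b θ * sin (2 * φ)) :=
  (((hasDerivAt_cos_two_mul φ).const_mul (b θ)).const_add (a θ)).deriv.trans (by ring)

lemma dPhi_mul_cos (b : ℝ → ℝ) (θ φ : ℝ) :
    dPhi (fun t p => b t * cos (2 * p)) θ φ = -(2 * b θ * sin (2 * φ)) :=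
  ((hasDerivAt_cos_two_mul φ).const_mul (b θ)).deriv.trans (by ring)

lemma dPhi_mul_sin (b : ℝ → ℝ) (θ φ : ℝ) :
    dPhi (fun t p => b t * sin (2 * p)) θ φ = 2 * b θ * cos (2 * φ) :=
  ((hasDerivAt_sin_two_mul φ).const_mul (b θ)).deriv.trans (by ring)

lemma dTheta_add_mul (a : ℝ) {b : ℝ → ℝ} {b' θ : ℝ} (h : HasDerivAt b b' θ) (g : ℝ → ℝ)
    (φ : ℝ) : dTheta (fun t p => a + b t * g p) θ φ = b' * g φ :=
  ((h.mul_const (g φ)).const_add a).deriv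

lemma dTheta_mul {b : ℝ → ℝ} {b' θ : ℝ} (h : HasDerivAt b b' θ) (g : ℝ → ℝ)
    (φ : ℝ) : dTheta (fun t p => b t * g p) θ φ = b' * g φ :=
  (h.mul_const (g φ)).deriv

lemma hasDerivAt_add_mul_cos_sq (b d θ : ℝ) :
    HasDerivAt (fun t => b + d * cos t ^ 2) (-(2 * d * cos θ * sin θ)) θ := by
  refine ((((hasDerivAt_cos θ).pow 2).const_mul d).const_add b).congr_deriv ?_
  simp; ring

lemma hasDerivAt_mul_sin_mul_cos (k θ : ℝ) :
    HasDerivAt (fun t => k * sin t * cos t) (k * (cos θ ^ 2 - sin θ ^ 2)) θ := by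
  refine (((hasDerivAt_sin θ).const_mul k).mul (hasDerivAt_cos θ)).congr_deriv ?_
  ring

section Shape

variable (u0 Ur Ut : ℝ) (θ φ : ℝ)

lemma shearShape_r : (shearShape u0 Ur Ut).r
    = fun t p => u0 + (Ur + (-Ur) * cos t ^ 2) * cos (2 * p) := by
  funext t p; simp only [shearShape]; rw [sin_sq]; ring

lemma shearShape_θ : (shearShape u0 Ur Ut).θ
    = fun t p => (Ut * sin t * cos t) * cos (2 * p) := rfl

lemma shearShape_φ : (shearShape u0 Ur Ut).φ
    = fun t p => (-Ut * sin t) * sin (2 * p) := by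
  funext t p; simp only [shearShape]; ring

lemma dTheta_shearShape_r :
    dTheta (shearShape u0 Ur Ut).r = fun t p => (2 * Ur * sin t * cos t) * cos (2 * p) := by
  funext t p
  rw [shearShape_r, dTheta_add_mul _ (hasDerivAt_add_mul_cos_sq _ _ _)]; ring

lemma dTheta_shearShape_θ :
    dTheta (shearShape u0 Ur Ut).θ θ φ = Ut * (cos θ ^ 2 - sin θ ^ 2) * cos (2 * φ) := by
  rw [shearShape_θ, dTheta_mul (hasDerivAt_mul_sin_mul_cos _ _)]

lemma dTheta_shearShape_φ :
    dTheta (shearShape u0 Ur Ut).φ θ φ = -Ut * cos θ * sin (2 * φ) := by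
  rw [shearShape_φ, dTheta_mul ((hasDerivAt_sin θ).const_mul _)]

lemma dPhi_shearShape_r :
    dPhi (shearShape u0 Ur Ut).r = fun t p => (-2 * Ur + 2 * Ur * cos t ^ 2) * sin (2 * p) := by
  funext t p
  rw [shearShape_r, dPhi_add_mul_cos (fun _ => u0) (fun t => Ur + (-Ur) * cos t ^ 2)]; ring

lemma dPhi_shearShape_θ :
    dPhi (shearShape u0 Ur Ut).θ θ φ = -2 * Ut * sin θ * cos θ * sin (2 * φ) := by
  rw [shearShape_θ, dPhi_mul_cos (fun t => Ut * sin t * cos t)]; ring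

lemma dPhi_shearShape_φ :
    dPhi (shearShape u0 Ur Ut).φ θ φ = -2 * Ut * sin θ * cos (2 * φ) := by
  rw [shearShape_φ, dPhi_mul_sin (fun t => -Ut * sin t)]; ring

end Shape

/-! ### Surface stresses and couple stresses of the simple-shear shape -/

section ClosedForms

variable (S : Interface) {r : ℝ} (u0 Ur Ut : ℝ) (hr : r ≠ 0)
include hr

/-- The division by sin θ cancels. Here and below the result is arranged as a function of θ times
cos 2φ or sin 2φ, plus a constant, to match the differentiation rules above. -/
lemma Ttt_shearShape (θ φ : ℝ) (hθ : sin θ ≠ 0) : Ttt S r (shearShape u0 Ur Ut) θ φ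
    = (S.σ₀ + 2 * (S.lam₀ + S.μ₀) * u0 / r + S.σ₀ * u0 / r)
      + (((S.lam₀ + S.σ₀) * (Ur - 2 * Ut) + (S.lam₀ + 2 * S.μ₀) * (Ur - Ut)) / r
        + ((S.lam₀ + S.σ₀) * (Ut - Ur) + (S.lam₀ + 2 * S.μ₀) * (2 * Ut - Ur)) / r * cos θ ^ 2)
        * cos (2 * φ) := by
  simp only [Ttt, dPhi_shearShape_φ, dTheta_shearShape_θ]
  simp only [shearShape]
  field_simp
  rw [sin_sq]; ring

lemma Tpp_shearShape (θ φ : ℝ) (hθ : sin θ ≠ 0) : Tpp S r (shearShape u0 Ur Ut) θ φ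
    = (S.σ₀ + 2 * (S.lam₀ + S.μ₀) * u0 / r + S.σ₀ * u0 / r)
      + (((S.lam₀ + 2 * S.μ₀) * (Ur - 2 * Ut) + (S.lam₀ + S.σ₀) * (Ur - Ut)) / r
        + ((S.lam₀ + 2 * S.μ₀) * (Ut - Ur) + (S.lam₀ + S.σ₀) * (2 * Ut - Ur)) / r * cos θ ^ 2)
        * cos (2 * φ) := by
  simp only [Tpp, dPhi_shearShape_φ, dTheta_shearShape_θ]
  simp only [shearShape]
  field_simp
  rw [sin_sq]; ring

lemma Tpt_shearShape (θ φ : ℝ) (hθ : sin θ ≠ 0) : Tpt S r (shearShape u0 Ur Ut) θ φ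
    = ((S.σ₀ - 2 * S.μ₀) * Ut / r * cos θ) * sin (2 * φ) := by
  simp only [Tpt, dPhi_shearShape_θ, dTheta_shearShape_φ]
  simp only [shearShape]
  field_simp
  ring

lemma Ttp_shearShape (θ φ : ℝ) (hθ : sin θ ≠ 0) : Ttp S r (shearShape u0 Ur Ut) θ φ
    = ((S.σ₀ - 2 * S.μ₀) * Ut / r * cos θ) * sin (2 * φ) := by
  simp only [Ttp, dPhi_shearShape_θ, dTheta_shearShape_φ]
  simp only [shearShape]
  field_simp
  ring

omit hr in
lemma Ttr_shearShape (θ φ : ℝ) : Ttr S r (shearShape u0 Ur Ut) θ φ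
    = (S.σ₀ * (2 * Ur - Ut) / r * sin θ * cos θ) * cos (2 * φ) := by
  simp only [Ttr, dTheta_shearShape_r]
  simp only [shearShape]
  ring

lemma Tpr_shearShape (θ φ : ℝ) (hθ : sin θ ≠ 0) : Tpr S r (shearShape u0 Ur Ut) θ φ
    = (S.σ₀ * (Ut - 2 * Ur) / r * sin θ) * sin (2 * φ) := by
  simp only [Tpr, dPhi_shearShape_r]
  simp only [shearShape]
  field_simp
  linear_combination (2 * Ur * S.σ₀ * sin (2 * φ)) * sin_sq_add_cos_sq θ

/-- The changes of curvature are the symmetrized derivatives of ∇u_r - u_tan = (Ur - Ut/2)∇Y. So all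
three carry the factor 2Ur - Ut, and u0 drops out. -/
lemma kpp_shearShape (θ φ : ℝ) (hθ : sin θ ≠ 0) : kpp r (shearShape u0 Ur Ut) θ φ
    = (2 * Ur - Ut) * (2 - cos θ ^ 2) / r ^ 2 * cos (2 * φ) := by
  simp only [kpp, dPhi_shearShape_r, dPhi_shearShape_φ, dTheta_shearShape_r,
    dPhi_mul_sin (fun t => -2 * Ur + 2 * Ur * cos t ^ 2)]
  simp only [shearShape]
  field_simp
  linear_combination (-4 * Ur * cos (2 * φ)) * sin_sq_add_cos_sq θ

omit hr in
lemma ktt_shearShape (θ φ : ℝ) : ktt r (shearShape u0 Ur Ut) θ φ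
    = (2 * Ur - Ut) * (1 - 2 * cos θ ^ 2) / r ^ 2 * cos (2 * φ) := by
  simp only [ktt, dTheta_shearShape_r, dTheta_shearShape_θ,
    dTheta_mul (hasDerivAt_mul_sin_mul_cos _ _)]
  rw [sin_sq]; ring

lemma kpt_shearShape (θ φ : ℝ) (hθ : sin θ ≠ 0) : kpt r (shearShape u0 Ur Ut) θ φ
    = (2 * Ur - Ut) * cos θ / r ^ 2 * sin (2 * φ) := by
  have h1 : dTheta (fun t p => dPhi (shearShape u0 Ur Ut).r t p / sin t
      - (shearShape u0 Ur Ut).φ t p) θ φ = (Ut - 2 * Ur) * cos θ * sin (2 * φ) := by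
    rw [dTheta_congr (g := fun t p => ((Ut - 2 * Ur) * sin t) * sin (2 * p)) hθ,
      dTheta_mul ((hasDerivAt_sin θ).const_mul _)]
    intro t p ht
    simp only [dPhi_shearShape_r]
    simp only [shearShape]
    field_simp
    linear_combination (2 * Ur * sin (2 * p)) * sin_sq_add_cos_sq t
  have h2 : dTheta (dPhi (shearShape u0 Ur Ut).r) θ φ
      = -(2 * (2 * Ur) * cos θ * sin θ) * sin (2 * φ) := by
    rw [dPhi_shearShape_r, dTheta_mul (hasDerivAt_add_mul_cos_sq _ _ _)]
  rw [kpt, h1, h2]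
  simp only [dPhi_shearShape_r, dPhi_shearShape_θ]
  simp only [shearShape]
  field_simp
  linear_combination (2 * Ur * cos θ * sin (2 * φ)) * sin_sq_add_cos_sq θ

lemma Mpp_shearShape (θ φ : ℝ) (hθ : sin θ ≠ 0) : Mpp S r (shearShape u0 Ur Ut) θ φ
    = ((2 * Ur - Ut) / r ^ 2 * (4 * S.χ₀ + 3 * S.ζ₀)
      + -((2 * Ur - Ut) / r ^ 2 * (2 * S.χ₀ + 3 * S.ζ₀)) * cos θ ^ 2) * cos (2 * φ) := by
  rw [Mpp, kpp_shearShape _ _ _ hr _ _ hθ, ktt_shearShape]; ring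

lemma Mtt_shearShape (θ φ : ℝ) (hθ : sin θ ≠ 0) : Mtt S r (shearShape u0 Ur Ut) θ φ
    = ((2 * Ur - Ut) / r ^ 2 * (2 * S.χ₀ + 3 * S.ζ₀)
      + -((2 * Ur - Ut) / r ^ 2 * (4 * S.χ₀ + 3 * S.ζ₀)) * cos θ ^ 2) * cos (2 * φ) := by
  rw [Mtt, kpp_shearShape _ _ _ hr _ _ hθ, ktt_shearShape]; ring

lemma Mpt_shearShape (θ φ : ℝ) (hθ : sin θ ≠ 0) : Mpt S r (shearShape u0 Ur Ut) θ φ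
    = ((2 * Ur - Ut) / r ^ 2 * (2 * S.χ₀) * cos θ) * sin (2 * φ) := by
  rw [Mpt, kpt_shearShape _ _ _ hr _ _ hθ]; ring

/-! ### Derivatives of the surface stresses -/

variable (θ φ : ℝ) (hθ : sin θ ≠ 0)
include hθ

lemma dPhi_Tpr_shearShape : dPhi (Tpr S r (shearShape u0 Ur Ut)) θ φ
    = 2 * (S.σ₀ * (Ut - 2 * Ur) / r * sin θ) * cos (2 * φ) := by
  rw [dPhi_congr hθ (Tpr_shearShape S u0 Ur Ut hr),
    dPhi_mul_sin (fun t => S.σ₀ * (Ut - 2 * Ur) / r * sin t)]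

omit hr in
lemma dTheta_Ttr_shearShape : dTheta (Ttr S r (shearShape u0 Ur Ut)) θ φ
    = S.σ₀ * (2 * Ur - Ut) / r * (cos θ ^ 2 - sin θ ^ 2) * cos (2 * φ) := by
  rw [dTheta_congr hθ (fun t p _ => Ttr_shearShape S u0 Ur Ut t p),
    dTheta_mul (hasDerivAt_mul_sin_mul_cos _ _)]

lemma dPhi_Tpt_shearShape : dPhi (Tpt S r (shearShape u0 Ur Ut)) θ φ
    = 2 * ((S.σ₀ - 2 * S.μ₀) * Ut / r * cos θ) * cos (2 * φ) := by
  rw [dPhi_congr hθ (Tpt_shearShape S u0 Ur Ut hr),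
    dPhi_mul_sin (fun t => (S.σ₀ - 2 * S.μ₀) * Ut / r * cos t)]

lemma dTheta_Ttp_shearShape : dTheta (Ttp S r (shearShape u0 Ur Ut)) θ φ
    = (S.σ₀ - 2 * S.μ₀) * Ut / r * -sin θ * sin (2 * φ) := by
  rw [dTheta_congr hθ (Ttp_shearShape S u0 Ur Ut hr),
    dTheta_mul ((hasDerivAt_cos θ).const_mul _)]

lemma dTheta_Ttt_shearShape : dTheta (Ttt S r (shearShape u0 Ur Ut)) θ φ
    = -(2 * (((S.lam₀ + S.σ₀) * (Ut - Ur) + (S.lam₀ + 2 * S.μ₀) * (2 * Ut - Ur)) / r)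
      * cos θ * sin θ) * cos (2 * φ) := by
  rw [dTheta_congr hθ (Ttt_shearShape S u0 Ur Ut hr),
    dTheta_add_mul _ (hasDerivAt_add_mul_cos_sq _ _ _)]

lemma dPhi_Tpp_shearShape : dPhi (Tpp S r (shearShape u0 Ur Ut)) θ φ
    = -(2 * (((S.lam₀ + 2 * S.μ₀) * (Ur - 2 * Ut) + (S.lam₀ + S.σ₀) * (Ur - Ut)) / r
        + ((S.lam₀ + 2 * S.μ₀) * (Ut - Ur) + (S.lam₀ + S.σ₀) * (2 * Ut - Ur)) / r * cos θ ^ 2)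
        * sin (2 * φ)) := by
  rw [dPhi_congr hθ (Tpp_shearShape S u0 Ur Ut hr),
    dPhi_add_mul_cos (fun _ => _) (fun t =>
      ((S.lam₀ + 2 * S.μ₀) * (Ur - 2 * Ut) + (S.lam₀ + S.σ₀) * (Ur - Ut)) / r
        + ((S.lam₀ + 2 * S.μ₀) * (Ut - Ur) + (S.lam₀ + S.σ₀) * (2 * Ut - Ur)) / r * cos t ^ 2)]

lemma gurtinMurdochJump_shearShape_r :
    (gurtinMurdochJump S r (shearShape u0 Ur Ut)).r θ φ
      = -(2 * S.σ₀ / r) - 2 * (2 * S.μ₀ + 2 * S.lam₀ + S.σ₀) * u0 / r ^ 2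
        + 1 / r ^ 2 * (6 * (S.lam₀ + S.μ₀ + S.σ₀) * Ut - 4 * (S.μ₀ + S.lam₀ + 2 * S.σ₀) * Ur)
          * sin θ ^ 2 * cos (2 * φ) := by
  simp only [gurtinMurdochJump, dPhi_Tpr_shearShape S u0 Ur Ut hr θ φ hθ,
    Ttr_shearShape S u0 Ur Ut θ φ, dTheta_Ttr_shearShape S u0 Ur Ut θ φ hθ,
    Tpp_shearShape S u0 Ur Ut hr θ φ hθ, Ttt_shearShape S u0 Ur Ut hr θ φ hθ]
  field_simp
  rw [sin_sq]; ring

lemma gurtinMurdochJump_shearShape_θ :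
    (gurtinMurdochJump S r (shearShape u0 Ur Ut)).θ θ φ
      = 1 / r ^ 2 * (-(3 * S.lam₀ + 5 * S.μ₀ + S.σ₀) * Ut + 2 * (S.μ₀ + S.lam₀ + S.σ₀) * Ur)
        * sin (2 * θ) * cos (2 * φ) := by
  simp only [gurtinMurdochJump, dPhi_Tpt_shearShape S u0 Ur Ut hr θ φ hθ,
    Ttr_shearShape S u0 Ur Ut θ φ, dTheta_Ttt_shearShape S u0 Ur Ut hr θ φ hθ,
    Tpp_shearShape S u0 Ur Ut hr θ φ hθ, Ttt_shearShape S u0 Ur Ut hr θ φ hθ]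
  rw [sin_two_mul]
  field_simp
  rw [sin_sq]; ring

lemma gurtinMurdochJump_shearShape_φ :
    (gurtinMurdochJump S r (shearShape u0 Ur Ut)).φ θ φ
      = 2 / r ^ 2 * ((3 * S.lam₀ + 5 * S.μ₀ + S.σ₀) * Ut - 2 * (S.μ₀ + S.lam₀ + S.σ₀) * Ur)
        * sin θ * sin (2 * φ) := by
  simp only [gurtinMurdochJump, dPhi_Tpp_shearShape S u0 Ur Ut hr θ φ hθ,
    Tpr_shearShape S u0 Ur Ut hr θ φ hθ, dTheta_Ttp_shearShape S u0 Ur Ut hr θ φ hθ,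
    Tpt_shearShape S u0 Ur Ut hr θ φ hθ, Ttp_shearShape S u0 Ur Ut hr θ φ hθ]
  field_simp
  rw [sin_sq]; ring

/-! ### Derivatives of the surface couple stresses -/

lemma dTheta_Mpp_shearShape : dTheta (Mpp S r (shearShape u0 Ur Ut)) θ φ
    = -(2 * -((2 * Ur - Ut) / r ^ 2 * (2 * S.χ₀ + 3 * S.ζ₀)) * cos θ * sin θ)
      * cos (2 * φ) := by
  rw [dTheta_congr hθ (Mpp_shearShape S u0 Ur Ut hr),
    dTheta_mul (hasDerivAt_add_mul_cos_sq _ _ _)]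

lemma dTheta_Mtt_shearShape : dTheta (Mtt S r (shearShape u0 Ur Ut)) θ φ
    = (2 * ((2 * Ur - Ut) / r ^ 2 * (4 * S.χ₀ + 3 * S.ζ₀)) * sin θ * cos θ)
      * cos (2 * φ) := by
  rw [dTheta_congr hθ (Mtt_shearShape S u0 Ur Ut hr),
    dTheta_mul (hasDerivAt_add_mul_cos_sq _ _ _)]
  ring

lemma dTheta_dTheta_Mtt_shearShape : dTheta (dTheta (Mtt S r (shearShape u0 Ur Ut))) θ φ
    = 2 * ((2 * Ur - Ut) / r ^ 2 * (4 * S.χ₀ + 3 * S.ζ₀)) * (cos θ ^ 2 - sin θ ^ 2)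
      * cos (2 * φ) := by
  rw [dTheta_congr hθ (dTheta_Mtt_shearShape S u0 Ur Ut hr),
    dTheta_mul (hasDerivAt_mul_sin_mul_cos _ _)]

lemma dPhi_Mpp_shearShape : dPhi (Mpp S r (shearShape u0 Ur Ut)) θ φ
    = (-2 * ((2 * Ur - Ut) / r ^ 2 * (4 * S.χ₀ + 3 * S.ζ₀)
      + -((2 * Ur - Ut) / r ^ 2 * (2 * S.χ₀ + 3 * S.ζ₀)) * cos θ ^ 2)) * sin (2 * φ) := by
  rw [dPhi_congr hθ (Mpp_shearShape S u0 Ur Ut hr),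
    dPhi_mul_cos (fun t => (2 * Ur - Ut) / r ^ 2 * (4 * S.χ₀ + 3 * S.ζ₀)
      + -((2 * Ur - Ut) / r ^ 2 * (2 * S.χ₀ + 3 * S.ζ₀)) * cos t ^ 2)]
  ring

lemma dPhi_dPhi_Mpp_shearShape : dPhi (dPhi (Mpp S r (shearShape u0 Ur Ut))) θ φ
    = -4 * ((2 * Ur - Ut) / r ^ 2 * (4 * S.χ₀ + 3 * S.ζ₀)
      + -((2 * Ur - Ut) / r ^ 2 * (2 * S.χ₀ + 3 * S.ζ₀)) * cos θ ^ 2) * cos (2 * φ) := by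
  rw [dPhi_congr hθ (dPhi_Mpp_shearShape S u0 Ur Ut hr),
    dPhi_mul_sin (fun t => -2 * ((2 * Ur - Ut) / r ^ 2 * (4 * S.χ₀ + 3 * S.ζ₀)
      + -((2 * Ur - Ut) / r ^ 2 * (2 * S.χ₀ + 3 * S.ζ₀)) * cos t ^ 2))]
  ring

lemma dPhi_Mpt_shearShape : dPhi (Mpt S r (shearShape u0 Ur Ut)) θ φ
    = (2 * ((2 * Ur - Ut) / r ^ 2 * (2 * S.χ₀)) * cos θ) * cos (2 * φ) := by
  rw [dPhi_congr hθ (Mpt_shearShape S u0 Ur Ut hr),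
    dPhi_mul_sin (fun t => (2 * Ur - Ut) / r ^ 2 * (2 * S.χ₀) * cos t)]
  ring

lemma dTheta_Mpt_shearShape : dTheta (Mpt S r (shearShape u0 Ur Ut)) θ φ
    = ((2 * Ur - Ut) / r ^ 2 * (2 * S.χ₀) * -sin θ) * sin (2 * φ) := by
  rw [dTheta_congr hθ (Mpt_shearShape S u0 Ur Ut hr),
    dTheta_mul ((hasDerivAt_cos θ).const_mul _)]

lemma dTheta_dPhi_Mpt_shearShape : dTheta (dPhi (Mpt S r (shearShape u0 Ur Ut))) θ φ
    = (2 * ((2 * Ur - Ut) / r ^ 2 * (2 * S.χ₀)) * -sin θ) * cos (2 * φ) := by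
  rw [dTheta_congr hθ (dPhi_Mpt_shearShape S u0 Ur Ut hr),
    dTheta_mul ((hasDerivAt_cos θ).const_mul _)]

lemma dPhi_dTheta_Mpt_shearShape : dPhi (dTheta (Mpt S r (shearShape u0 Ur Ut))) θ φ
    = 2 * ((2 * Ur - Ut) / r ^ 2 * (2 * S.χ₀) * -sin θ) * cos (2 * φ) := by
  rw [dPhi_congr hθ (dTheta_Mpt_shearShape S u0 Ur Ut hr),
    dPhi_mul_sin (fun t => (2 * Ur - Ut) / r ^ 2 * (2 * S.χ₀) * -sin t)]

/-- The curvature change is -(Ur - Ut/2)/r² times the Hessian of Y. On the unit sphere div Hess Y =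
∇ΔY + ∇Y = -5∇Y and tr Hess Y = -6Y, so the couple stress has divergence proportional to (5χ₀ +
3ζ₀)∇Y; a second divergence gives the factor -6 here. -/
lemma steigmannOgdenJump_shearShape_r :
    (steigmannOgdenJump S r (shearShape u0 Ur Ut)).r θ φ
      = (gurtinMurdochJump S r (shearShape u0 Ur Ut)).r θ φ
        - 6 * (5 * S.χ₀ + 3 * S.ζ₀) / r ^ 4 * (2 * Ur - Ut) * sin θ ^ 2 * cos (2 * φ) := by
  have e : Mtp S r (shearShape u0 Ur Ut) = Mpt S r (shearShape u0 Ur Ut) := rfl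
  simp only [steigmannOgdenJump, e, dPhi_dPhi_Mpp_shearShape S u0 Ur Ut hr θ φ hθ,
    dPhi_dTheta_Mpt_shearShape S u0 Ur Ut hr θ φ hθ,
    dTheta_dPhi_Mpt_shearShape S u0 Ur Ut hr θ φ hθ,
    dTheta_dTheta_Mtt_shearShape S u0 Ur Ut hr θ φ hθ,
    dPhi_Mpt_shearShape S u0 Ur Ut hr θ φ hθ, dTheta_Mtt_shearShape S u0 Ur Ut hr θ φ hθ,
    dTheta_Mpp_shearShape S u0 Ur Ut hr θ φ hθ,
    Mpp_shearShape S u0 Ur Ut hr θ φ hθ, Mtt_shearShape S u0 Ur Ut hr θ φ hθ]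
  rw [sub_eq_add_neg]
  congr 1
  -- Normalization produces fourth powers of the sine, which the rewrite by `sin_sq` does not match.
  have h4 : sin θ ^ 4 = (1 - cos θ ^ 2) ^ 2 := by rw [← sin_sq]; ring
  field_simp
  ring_nf
  simp only [h4, sin_sq]
  ring

lemma steigmannOgdenJump_shearShape_θ :
    (steigmannOgdenJump S r (shearShape u0 Ur Ut)).θ θ φ
      = (gurtinMurdochJump S r (shearShape u0 Ur Ut)).θ θ φ
        + (5 * S.χ₀ + 3 * S.ζ₀) / r ^ 4 * (2 * Ur - Ut) * sin (2 * θ) * cos (2 * φ) := by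
  simp only [steigmannOgdenJump,
    dPhi_Mpt_shearShape S u0 Ur Ut hr θ φ hθ, dTheta_Mtt_shearShape S u0 Ur Ut hr θ φ hθ,
    Mpp_shearShape S u0 Ur Ut hr θ φ hθ, Mtt_shearShape S u0 Ur Ut hr θ φ hθ]
  congr 1
  rw [sin_two_mul]
  field_simp
  rw [sin_sq]; ring

lemma steigmannOgdenJump_shearShape_φ :
    (steigmannOgdenJump S r (shearShape u0 Ur Ut)).φ θ φ
      = (gurtinMurdochJump S r (shearShape u0 Ur Ut)).φ θ φ
        - 2 * (5 * S.χ₀ + 3 * S.ζ₀) / r ^ 4 * (2 * Ur - Ut) * sin θ * sin (2 * φ) := by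
  have e : Mtp S r (shearShape u0 Ur Ut) = Mpt S r (shearShape u0 Ur Ut) := rfl
  simp only [steigmannOgdenJump, e,
    dPhi_Mpp_shearShape S u0 Ur Ut hr θ φ hθ, dTheta_Mpt_shearShape S u0 Ur Ut hr θ φ hθ,
    Mpt_shearShape S u0 Ur Ut hr θ φ hθ]
  rw [sub_eq_add_neg]
  congr 1
  field_simp
  rw [sin_sq]; ring

end ClosedForms

/-! ### Gradients of scalar fields -/

/-- `f` is differentiable at `x` with partial derivatives `v`. -/
def HasGrad (f : E3 → ℝ) (v : Fin 3 → ℝ) (x : E3) : Prop :=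
  DifferentiableAt ℝ f x ∧ ∀ j, partialDeriv j f x = v j

namespace HasGrad

variable {f g : E3 → ℝ} {v w : Fin 3 → ℝ} {x : E3}

lemma partialDeriv_eq (h : HasGrad f v x) (j : Fin 3) : partialDeriv j f x = v j := h.2 j

lemma const (a : ℝ) (x : E3) : HasGrad (fun _ => a) (fun _ => 0) x :=
  ⟨differentiableAt_const a, fun j => by simp [partialDeriv]⟩

lemma coord (i : Fin 3) (x : E3) : HasGrad (fun y => y i) (fun j => if i = j then 1 else 0) x := by
  have h : HasFDerivAt (fun y : E3 => y i) (EuclideanSpace.proj i : E3 →L[ℝ] ℝ) x :=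
    (EuclideanSpace.proj i : E3 →L[ℝ] ℝ).hasFDerivAt
  refine ⟨h.differentiableAt, fun j => ?_⟩
  rw [partialDeriv, h.fderiv]
  simp

lemma add (hf : HasGrad f v x) (hg : HasGrad g w x) :
    HasGrad (fun y => f y + g y) (fun j => v j + w j) x :=
  ⟨hf.1.add hg.1, fun j => by
    rw [partialDeriv, fderiv_fun_add hf.1 hg.1]; exact congrArg₂ (· + ·) (hf.2 j) (hg.2 j)⟩

lemma mul (hf : HasGrad f v x) (hg : HasGrad g w x) :
    HasGrad (fun y => f y * g y) (fun j => f x * w j + g x * v j) x :=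
  ⟨hf.1.mul hg.1, fun j => by
    rw [partialDeriv, fderiv_fun_mul hf.1 hg.1]
    exact congrArg₂ (fun a b => f x * a + g x * b) (hg.2 j) (hf.2 j)⟩

lemma const_mul (a : ℝ) (hf : HasGrad f v x) :
    HasGrad (fun y => a * f y) (fun j => a * v j) x := by
  simpa using (const a x).mul hf

/-- Using ‖x‖² instead of ‖x‖ as the variable avoids a singularity at the origin, so the centre of
the ball needs no separate treatment. -/
lemma radial {α : ℝ → ℝ} {α' : ℝ} (h : HasDerivAt α α' (‖x‖ ^ 2)) :
    HasGrad (fun y => α (‖y‖ ^ 2)) (fun j => 2 * α' * x j) x := by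
  have h1 := h.comp_hasFDerivAt x (hasStrictFDerivAt_norm_sq x).hasFDerivAt
  refine ⟨h1.differentiableAt, fun j => ?_⟩
  rw [partialDeriv]
  erw [h1.fderiv]
  simp [EuclideanSpace.inner_single_right]
  ring

lemma congr_grad (hf : HasGrad f v x) (h : ∀ j, v j = w j) : HasGrad f w x :=
  ⟨hf.1, fun j => (hf.2 j).trans (h j)⟩

lemma congr (hf : HasGrad f v x) (h : g =ᶠ[𝓝 x] f) : HasGrad g v x :=
  ⟨h.differentiableAt_iff.2 hf.1, fun j => by rw [partialDeriv, h.fderiv_eq]; exact hf.2 j⟩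

end HasGrad

/-! ### Displacement fields built on the shear harmonic `x₀² - x₁²` -/

/-- The quadratic harmonic of simple shear. -/
def shearPoly (x : E3) : ℝ := x 0 ^ 2 - x 1 ^ 2

/-- The diagonal of half the Hessian of `shearPoly`. -/
def shearSign : Fin 3 → ℝ := ![1, -1, 0]

/-- Coefficient functions of a displacement field, together with their first two derivatives. -/
structure Profile where
  α : ℝ → ℝ
  α' : ℝ → ℝ
  α'' : ℝ → ℝ
  β : ℝ → ℝ
  β' : ℝ → ℝ
  β'' : ℝ → ℝ
  δ : ℝ → ℝ
  δ' : ℝ → ℝ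
  δ'' : ℝ → ℝ

namespace Profile

/-- The primed fields of `p` are derivatives on `Ω`. -/
structure HasDerivsOn (p : Profile) (Ω : Set ℝ) : Prop where
  α : ∀ s ∈ Ω, HasDerivAt p.α (p.α' s) s
  α' : ∀ s ∈ Ω, HasDerivAt p.α' (p.α'' s) s
  β : ∀ s ∈ Ω, HasDerivAt p.β (p.β' s) s
  β' : ∀ s ∈ Ω, HasDerivAt p.β' (p.β'' s) s
  δ : ∀ s ∈ Ω, HasDerivAt p.δ (p.δ' s) s
  δ' : ∀ s ∈ Ω, HasDerivAt p.δ' (p.δ'' s) s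

/-- The displacement field `α ∇P + (β P + δ) x`, with `P = shearPoly` and coefficients
evaluated at `‖x‖²`. -/
def field (p : Profile) (x : E3) : E3 := WithLp.toLp 2 fun i =>
  p.α (‖x‖ ^ 2) * (2 * shearSign i * x i)
    + (p.β (‖x‖ ^ 2) * shearPoly x + p.δ (‖x‖ ^ 2)) * x i

variable (m : Material) (p : Profile)

/-- The coefficient of `shearPoly` in the isotropic part of the stress. -/
def iso₂ (s : ℝ) : ℝ := m.lam * (4 * p.α' s + 2 * (s * p.β' s) + 5 * p.β s) + 2 * m.μ * p.β s

/-- The radial term in the isotropic part of the stress. -/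
def iso₀ (s : ℝ) : ℝ := m.lam * (2 * (s * p.δ' s) + 3 * p.δ s) + 2 * m.μ * p.δ s

/-- The stress of `p.field`. -/
def fieldStress (x : E3) (i j : Fin 3) : ℝ :=
  (p.iso₂ m (‖x‖ ^ 2) * shearPoly x + p.iso₀ m (‖x‖ ^ 2)) * (if i = j then 1 else 0)
    + 2 * m.μ * ((2 * p.α' (‖x‖ ^ 2) + p.β (‖x‖ ^ 2)) * ((shearSign i + shearSign j) * (x i * x j)))
    + 4 * m.μ * (p.α (‖x‖ ^ 2) * (if i = j then shearSign i else 0))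
    + 4 * m.μ * ((p.β' (‖x‖ ^ 2) * shearPoly x + p.δ' (‖x‖ ^ 2)) * (x i * x j))

end Profile

lemma hasGrad_shearPoly (x : E3) : HasGrad shearPoly (fun j => 2 * shearSign j * x j) x := by
  have h : shearPoly = fun y : E3 => y 0 * y 0 + (-1) * (y 1 * y 1) := by
    funext y; simp only [shearPoly]; ring
  rw [h]
  convert ((HasGrad.coord 0 x).mul (HasGrad.coord 0 x)).add
    (((HasGrad.coord 1 x).mul (HasGrad.coord 1 x)).const_mul (-1)) using 1
  funext j
  fin_cases j <;> simp [shearSign] <;> ring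

lemma norm_sq_eq (x : E3) : ‖x‖ ^ 2 = x 0 ^ 2 + x 1 ^ 2 + x 2 ^ 2 := by
  simp [EuclideanSpace.norm_sq_eq, Fin.sum_univ_three]

/-! ### Stress and equilibrium of the Cartesian fields -/

namespace Profile

variable {p : Profile} {Ω : Set ℝ} (m : Material)

lemma hasGrad_field (hp : p.HasDerivsOn Ω) {x : E3} (hx : ‖x‖ ^ 2 ∈ Ω) (i : Fin 3) :
    HasGrad (fun y => p.field y i) (fun j =>
      4 * p.α' (‖x‖ ^ 2) * shearSign i * (x i * x j)
        + 2 * p.α (‖x‖ ^ 2) * (if i = j then shearSign i else 0)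
        + (2 * p.β' (‖x‖ ^ 2) * shearPoly x + 2 * p.β (‖x‖ ^ 2) * shearSign j
            + 2 * p.δ' (‖x‖ ^ 2)) * (x i * x j)
        + (p.β (‖x‖ ^ 2) * shearPoly x + p.δ (‖x‖ ^ 2)) * (if i = j then 1 else 0)) x := by
  refine HasGrad.congr_grad (((HasGrad.radial (hp.α _ hx)).mul ((HasGrad.coord i x).const_mul (2 * shearSign i))).add
    ((((HasGrad.radial (hp.β _ hx)).mul (hasGrad_shearPoly x)).add
      (HasGrad.radial (hp.δ _ hx))).mul (HasGrad.coord i x))) fun j => ?_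
  split_ifs <;> ring

/-- The isotropic coefficients come from the divergence: P is harmonic and homogeneous of degree
two, so div(α∇P) = 4α'P, div(βPx) = (2sβ' + 5β)P and div(δx) = 2sδ' + 3δ, with s = ‖x‖². -/
lemma stress_field (hp : p.HasDerivsOn Ω) {x : E3} (hx : ‖x‖ ^ 2 ∈ Ω) (i j : Fin 3) :
    stress m p.field x i j = p.fieldStress m x i j := by
  simp only [stress, fieldStress, (hasGrad_field hp hx _).partialDeriv_eq, Fin.sum_univ_three,
    iso₂, iso₀]
  have hs := norm_sq_eq x
  have hP : shearPoly x = x 0 ^ 2 - x 1 ^ 2 := rfl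
  have hd : ∀ i j : Fin 3, (if j = i then shearSign j else 0) = if i = j then shearSign i else 0 := by
    intro i j; by_cases h : i = j
    · subst h; rfl
    · rw [if_neg h, if_neg (Ne.symm h)]
  have hd' : ∀ i j : Fin 3, (if j = i then (1 : ℝ) else 0) = if i = j then 1 else 0 := by
    intro i j; simp [eq_comm]
  rw [hd i j, hd' i j]
  simp only [if_true, shearSign, Matrix.cons_val_zero, Matrix.cons_val_one, Matrix.cons_val]
  generalize (if i = j then (1 : ℝ) else 0) = e
  linear_combination (-2 * m.lam * e * (p.β' (‖x‖ ^ 2) * shearPoly x + p.δ' (‖x‖ ^ 2))) * hs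
    - (4 * m.lam * e * p.α' (‖x‖ ^ 2) + 2 * m.lam * e * p.β (‖x‖ ^ 2)) * hP

lemma hasDerivAt_iso₂ (hp : p.HasDerivsOn Ω) {s : ℝ} (hs : s ∈ Ω) :
    HasDerivAt (p.iso₂ m) (m.lam * (4 * p.α'' s + 7 * p.β' s + 2 * s * p.β'' s)
      + 2 * m.μ * p.β' s) s := by
  refine ((((((hp.α' s hs).const_mul 4).add
    (((hasDerivAt_id s).mul (hp.β' s hs)).const_mul 2)).add
      ((hp.β s hs).const_mul 5)).const_mul m.lam).add
        ((hp.β s hs).const_mul (2 * m.μ))).congr_deriv ?_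
  simp only [id]; ring

lemma hasDerivAt_iso₀ (hp : p.HasDerivsOn Ω) {s : ℝ} (hs : s ∈ Ω) :
    HasDerivAt (p.iso₀ m) (m.lam * (5 * p.δ' s + 2 * s * p.δ'' s) + 2 * m.μ * p.δ' s) s := by
  refine ((((((hasDerivAt_id s).mul (hp.δ' s hs)).const_mul 2).add
      ((hp.δ s hs).const_mul 3)).const_mul m.lam).add
        ((hp.δ s hs).const_mul (2 * m.μ))).congr_deriv ?_
  simp only [id]; ring

lemma hasGrad_fieldStress (hp : p.HasDerivsOn Ω) {x : E3} (hx : ‖x‖ ^ 2 ∈ Ω) (i j : Fin 3) :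
    HasGrad (fun y => p.fieldStress m y i j) (fun k =>
      2 * ((m.lam * (4 * p.α'' (‖x‖ ^ 2) + 7 * p.β' (‖x‖ ^ 2) + 2 * ‖x‖ ^ 2 * p.β'' (‖x‖ ^ 2))
          + 2 * m.μ * p.β' (‖x‖ ^ 2)) * shearPoly x + p.iso₂ m (‖x‖ ^ 2) * shearSign k
        + (m.lam * (5 * p.δ' (‖x‖ ^ 2) + 2 * ‖x‖ ^ 2 * p.δ'' (‖x‖ ^ 2))
          + 2 * m.μ * p.δ' (‖x‖ ^ 2))) * x k * (if i = j then 1 else 0)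
      + 2 * m.μ * (shearSign i + shearSign j)
        * (2 * (2 * p.α'' (‖x‖ ^ 2) + p.β' (‖x‖ ^ 2)) * x k * (x i * x j)
          + (2 * p.α' (‖x‖ ^ 2) + p.β (‖x‖ ^ 2))
            * ((if i = k then 1 else 0) * x j + x i * (if j = k then 1 else 0)))
      + 8 * m.μ * p.α' (‖x‖ ^ 2) * x k * (if i = j then shearSign i else 0)
      + 4 * m.μ * (2 * (p.β'' (‖x‖ ^ 2) * shearPoly x + p.β' (‖x‖ ^ 2) * shearSign k
          + p.δ'' (‖x‖ ^ 2)) * x k * (x i * x j)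
          + (p.β' (‖x‖ ^ 2) * shearPoly x + p.δ' (‖x‖ ^ 2))
            * ((if i = k then 1 else 0) * x j + x i * (if j = k then 1 else 0)))) x := by
  have hxx := (HasGrad.coord i x).mul (HasGrad.coord j x)
  refine HasGrad.congr_grad ((((((HasGrad.radial (hasDerivAt_iso₂ m hp hx)).mul (hasGrad_shearPoly x)).add
      (HasGrad.radial (hasDerivAt_iso₀ m hp hx))).mul
        (HasGrad.const (if i = j then 1 else 0) x)).add
    ((((((HasGrad.radial (hp.α' _ hx)).const_mul 2).add (HasGrad.radial (hp.β _ hx))).mul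
      (hxx.const_mul (shearSign i + shearSign j))).const_mul (2 * m.μ)))).add
    (((HasGrad.radial (hp.α _ hx)).mul
      (HasGrad.const (if i = j then shearSign i else 0) x)).const_mul (4 * m.μ)) |>.add
    (((((HasGrad.radial (hp.β' _ hx)).mul (hasGrad_shearPoly x)).add
      (HasGrad.radial (hp.δ' _ hx))).mul hxx).const_mul (4 * m.μ))) fun k => ?_
  ring

/-- The coefficients of `∇P`, `P x` and `x` in the divergence of the stress vanish. -/
structure Balanced (m : Material) (p : Profile) (s : ℝ) : Prop where
  grad : p.iso₂ m s + m.μ * (2 * s * (2 * p.α'' s + p.β' s) + 14 * p.α' s + 5 * p.β s) = 0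
  poly : m.lam * (4 * p.α'' s + 7 * p.β' s + 2 * s * p.β'' s)
    + m.μ * (4 * p.α'' s + 16 * p.β' s + 4 * s * p.β'' s) = 0
  radial : m.lam * (5 * p.δ' s + 2 * s * p.δ'' s) + m.μ * (10 * p.δ' s + 4 * s * p.δ'' s) = 0

lemma equilibriumAt_field (hΩ : IsOpen Ω) (hp : p.HasDerivsOn Ω) {x : E3} (hx : ‖x‖ ^ 2 ∈ Ω)
    (hb : p.Balanced m (‖x‖ ^ 2)) : EquilibriumAt m p.field x := by
  intro i
  -- The formula for the stress is known only where ‖y‖² ∈ Ω; differentiating it requires a whole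
  -- neighbourhood.
  have hU : ∀ᶠ y : E3 in 𝓝 x, ‖y‖ ^ 2 ∈ Ω :=
    (continuous_norm.pow 2).continuousAt.eventually_mem (hΩ.mem_nhds hx)
  have h : ∀ j, partialDeriv j (fun y => stress m p.field y i j) x = _ := fun j =>
    ((hasGrad_fieldStress m hp hx i j).congr
      (hU.mono fun y hy => stress_field m hp hy i j)).partialDeriv_eq j
  simp only [h, Fin.sum_univ_three]
  have hs := norm_sq_eq x
  have hP : shearPoly x = x 0 ^ 2 - x 1 ^ 2 := rfl
  obtain ⟨h1, h2, h3⟩ := hb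
  simp only [iso₂] at h1 ⊢
  generalize ‖x‖ ^ 2 = s at *
  generalize p.α' s = a1 at *
  generalize p.α'' s = a2 at *
  generalize p.β s = b0 at *
  generalize p.β' s = b1 at *
  generalize p.β'' s = b2 at *
  generalize p.δ' s = d1 at *
  generalize p.δ'' s = d2 at *
  rw [hP]
  subst hs
  -- With the radial coefficients now free parameters, what remains is polynomial: div σ = `grad`·∇P
  -- + 2(`poly`·P + `radial`)x, where ∇P = 2(x₀, -x₁, 0).
  fin_cases i <;> simp [shearSign]
  · linear_combination (2 * x 0) * (h1 + (x 0 ^ 2 - x 1 ^ 2) * h2 + h3)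
  · linear_combination (2 * x 1) * (-h1 + (x 0 ^ 2 - x 1 ^ 2) * h2 + h3)
  · linear_combination (2 * x 2) * ((x 0 ^ 2 - x 1 ^ 2) * h2 + h3)

lemma contDiffAt_field {x : E3} (hα : ContDiffAt ℝ ∞ p.α (‖x‖ ^ 2))
    (hβ : ContDiffAt ℝ ∞ p.β (‖x‖ ^ 2)) (hδ : ContDiffAt ℝ ∞ p.δ (‖x‖ ^ 2)) :
    ContDiffAt ℝ ∞ p.field x := by
  have hn : ContDiffAt ℝ ∞ (fun y : E3 => ‖y‖ ^ 2) x := (contDiff_norm_sq ℝ).contDiffAt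
  have hc : ∀ i : Fin 3, ContDiffAt ℝ ∞ (fun y : E3 => y i) x := fun i =>
    (EuclideanSpace.proj i : E3 →L[ℝ] ℝ).contDiff.contDiffAt
  have hP : ContDiffAt ℝ ∞ shearPoly x := ((hc 0).pow 2).sub ((hc 1).pow 2)
  refine (contDiffAt_euclidean (𝕜 := ℝ)).2 fun i => ?_
  exact ((hα.comp x hn).mul (contDiffAt_const.mul (hc i))).add
    ((((hβ.comp x hn).mul hP).add (hδ.comp x hn)).mul (hc i))

end Profile

/-! ### Spherical coordinates -/

lemma norm_sq_sphPoint (r θ φ : ℝ) : ‖sphPoint r θ φ‖ ^ 2 = r ^ 2 := by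
  rw [norm_sq_eq]
  simp only [sphPoint, PiLp.toLp_apply, Matrix.cons_val_zero, Matrix.cons_val_one, Matrix.cons_val]
  linear_combination (r ^ 2 * sin θ ^ 2) * sin_sq_add_cos_sq φ + r ^ 2 * sin_sq_add_cos_sq θ

lemma norm_sphPoint {r : ℝ} (hr : 0 ≤ r) (θ φ : ℝ) : ‖sphPoint r θ φ‖ = r :=
  (pow_left_inj₀ (norm_nonneg _) hr two_ne_zero).1 (norm_sq_sphPoint r θ φ)

/-- For θ = arccos(x₂/‖x‖), the number ‖x‖ sin θ is the modulus of x₀ + i x₁, so its polar form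
gives the first two coordinates. On the axis the modulus is zero and the value of `arg` is
immaterial. -/
lemma exists_sphPoint (x : E3) :
    x = sphPoint ‖x‖ (arccos (x 2 / ‖x‖)) (Complex.arg ⟨x 0, x 1⟩) := by
  rcases eq_or_ne x 0 with rfl | hx
  · ext i; fin_cases i <;> simp [sphPoint]
  have hn : 0 < ‖x‖ := norm_pos_iff.2 hx
  have hs := norm_sq_eq x
  have hz : |x 2| ≤ ‖x‖ := abs_le_of_sq_le_sq (by nlinarith [sq_nonneg (x 0), sq_nonneg (x 1)]) hn.le
  have hz' := abs_le.1 hz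
  have hc : cos (arccos (x 2 / ‖x‖)) = x 2 / ‖x‖ :=
    cos_arccos ((le_div_iff₀ hn).2 (by linarith)) ((div_le_iff₀ hn).2 (by linarith))
  have hsin : ‖x‖ * sin (arccos (x 2 / ‖x‖)) = ‖(⟨x 0, x 1⟩ : ℂ)‖ := by
    rw [sin_arccos, Complex.norm_def, Complex.normSq_mk]
    nth_rewrite 1 [← sqrt_sq hn.le]
    rw [← sqrt_mul (sq_nonneg _)]
    congr 1
    field_simp
    linarith
  ext i
  fin_cases i
  · simp only [sphPoint, PiLp.toLp_apply, Matrix.cons_val_zero, Fin.zero_eta]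
    rw [← mul_assoc, hsin, Complex.norm_mul_cos_arg]
  · simp only [sphPoint, PiLp.toLp_apply, Matrix.cons_val_one, Matrix.cons_val_zero, Fin.mk_one]
    rw [← mul_assoc, hsin, Complex.norm_mul_sin_arg]
  · simp only [sphPoint, PiLp.toLp_apply, Matrix.cons_val, Fin.reduceFinMk]
    rw [hc, mul_div_cancel₀ _ hn.ne']

lemma inner_eq (x y : E3) : inner ℝ x y = x 0 * y 0 + x 1 * y 1 + x 2 * y 2 := by
  simp [PiLp.inner_apply, Fin.sum_univ_three]; ring

lemma sphTrace_eq_of_forall {u : E3 → E3} {r : ℝ} {c : SphComponents}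
    (h : ∀ θ φ, u (sphPoint r θ φ) = c.r θ φ • eR θ φ + c.θ θ φ • eTheta θ φ + c.φ θ φ • ePhi φ) :
    sphTrace u r = c := by
  obtain ⟨a, b, d⟩ := c
  simp only [sphTrace, h, SphComponents.mk.injEq]
  refine ⟨?_, ?_, ?_⟩ <;> funext θ φ <;>
    simp only [inner_eq, eR, eTheta, ePhi, PiLp.add_apply, PiLp.smul_apply, smul_eq_mul,
      Matrix.cons_val_zero, Matrix.cons_val_one, Matrix.cons_val] <;>
    generalize a θ φ = a <;> generalize b θ φ = b <;> generalize d θ φ = d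
  · linear_combination (a * sin θ ^ 2 + b * sin θ * cos θ) * sin_sq_add_cos_sq φ
      + a * sin_sq_add_cos_sq θ
  · linear_combination (a * sin θ * cos θ + b * cos θ ^ 2) * sin_sq_add_cos_sq φ
      + b * sin_sq_add_cos_sq θ
  · linear_combination d * sin_sq_add_cos_sq φ

lemma shearPoly_sphPoint (r θ φ : ℝ) :
    shearPoly (sphPoint r θ φ) = r ^ 2 * (sin θ ^ 2 * cos (2 * φ)) := by
  simp only [shearPoly, sphPoint, PiLp.toLp_apply, Matrix.cons_val_zero, Matrix.cons_val_one]
  rw [cos_two_mul']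
  ring

/-! ### Traces and tractions of the Cartesian fields on spheres -/

namespace Profile

variable (p : Profile)

/-- The spherical components of `p.field` on the sphere of radius `r`. -/
def components (r : ℝ) : SphComponents :=
  shearShape (r * p.δ (r ^ 2)) (2 * r * p.α (r ^ 2) + r ^ 3 * p.β (r ^ 2)) (2 * r * p.α (r ^ 2))

/-- On the sphere the Cartesian gradient of P = r²Y has radial part 2rY and tangential part r times
the unit-sphere gradient of Y. So α enters both amplitudes, β only the radial one. -/
lemma field_sphPoint (r θ φ : ℝ) : p.field (sphPoint r θ φ)
    = (p.components r).r θ φ • eR θ φ + (p.components r).θ θ φ • eTheta θ φ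
      + (p.components r).φ θ φ • ePhi φ := by
  ext i
  simp only [field, norm_sq_sphPoint, shearPoly_sphPoint, components, shearShape]
  generalize p.α (r ^ 2) = a
  generalize p.β (r ^ 2) = b
  generalize p.δ (r ^ 2) = d
  fin_cases i <;>
    simp [shearSign, sphPoint, eR, eTheta, ePhi]
  · rw [cos_two_mul', sin_two_mul]
    linear_combination (-2 * a * r * sin θ * cos φ * (cos φ ^ 2 - sin φ ^ 2)) * sin_sq_add_cos_sq θ
      - (2 * a * r * sin θ * cos φ) * sin_sq_add_cos_sq φ
  · rw [cos_two_mul', sin_two_mul]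
    linear_combination (-2 * a * r * sin θ * sin φ * (cos φ ^ 2 - sin φ ^ 2)) * sin_sq_add_cos_sq θ
      + (2 * a * r * sin θ * sin φ) * sin_sq_add_cos_sq φ
  · ring

lemma sphTrace_field (r : ℝ) : sphTrace p.field r = p.components r :=
  sphTrace_eq_of_forall (p.field_sphPoint r)

/-- The two fields agree at every point, axis and origin included; this is why r = 0 belongs to the
hypothesis. Smoothness and derivatives can then be read off the Cartesian formula. -/
lemma sphField_eq_field {c : ℝ → SphComponents} (h : ∀ r, 0 ≤ r → c r = p.components r) :
    sphField c = p.field := by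
  funext x
  conv_rhs => rw [exists_sphPoint x, field_sphPoint]
  simp only [sphField, h _ (norm_nonneg x)]

variable (m : Material)

/-- The isotropic normal traction of `p.field` on the sphere of radius `√s`. -/
def tractionIso (s : ℝ) : ℝ := p.iso₀ m s + 4 * m.μ * (s * p.δ' s)

/-- The amplitude of the shear harmonic in the normal traction. -/
def tractionNormal (s : ℝ) : ℝ :=
  p.iso₂ m s * s + 4 * m.μ * ((2 * p.α' s + p.β s) * s) + 4 * m.μ * p.α s
    + 4 * m.μ * (p.β' s * s ^ 2)

/-- The amplitude of the shear harmonic in the tangential tractions. -/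
def tractionTangential (s : ℝ) : ℝ :=
  2 * m.μ * ((2 * p.α' s + p.β s) * s) + 4 * m.μ * p.α s

/-- With Σ = diag(1, -1, 0), the stress at x = rn sends n to a combination of n and Σn, so only v·n
and v·Σn survive. For the tangential frame vectors the first one vanishes. -/
lemma sum_mul_fieldStress_mul {x : E3} {r : ℝ} {n : E3} (v : E3) (hx : ∀ i, x i = r * n i)
    (hn : n 0 ^ 2 + n 1 ^ 2 + n 2 ^ 2 = 1) :
    ∑ i, ∑ j, v i * p.fieldStress m x i j * n j
      = (p.iso₂ m (‖x‖ ^ 2) * shearPoly x + p.iso₀ m (‖x‖ ^ 2)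
          + 4 * m.μ * ((p.β' (‖x‖ ^ 2) * shearPoly x + p.δ' (‖x‖ ^ 2)) * r ^ 2)
          + 2 * m.μ * (2 * p.α' (‖x‖ ^ 2) + p.β (‖x‖ ^ 2)) * shearPoly x)
          * (v 0 * n 0 + v 1 * n 1 + v 2 * n 2)
        + (2 * m.μ * ((2 * p.α' (‖x‖ ^ 2) + p.β (‖x‖ ^ 2)) * r ^ 2) + 4 * m.μ * p.α (‖x‖ ^ 2))
          * (v 0 * n 0 - v 1 * n 1) := by
  have hP : shearPoly x = r ^ 2 * (n 0 ^ 2 - n 1 ^ 2) := by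
    rw [shearPoly, hx, hx]; ring
  simp only [fieldStress, Fin.sum_univ_three, hx, hP]
  generalize p.iso₂ m (‖x‖ ^ 2) = A
  generalize p.iso₀ m (‖x‖ ^ 2) = A₀
  generalize p.α (‖x‖ ^ 2) = a
  generalize 2 * p.α' (‖x‖ ^ 2) + p.β (‖x‖ ^ 2) = B
  generalize p.β' (‖x‖ ^ 2) = b
  generalize p.δ' (‖x‖ ^ 2) = d
  simp [shearSign]
  linear_combination (2 * m.μ * B * r ^ 2 * (v 0 * n 0 - v 1 * n 1)
    + 4 * m.μ * (b * (r ^ 2 * (n 0 ^ 2 - n 1 ^ 2)) + d) * r ^ 2 * (v 0 * n 0 + v 1 * n 1 + v 2 * n 2)) * hn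

variable {p} {Ω : Set ℝ} (hp : p.HasDerivsOn Ω)
include hp

/-- For the frame vectors, v·Σn equals Y and the halved components of ∇Y. Both tangential tractions
therefore share one amplitude, which makes the φ jump condition a consequence of the θ one. -/
lemma sphTraction_field {r : ℝ} (hr : r ^ 2 ∈ Ω) (θ φ : ℝ) :
    (sphTraction (stress m p.field) r).r θ φ
        = p.tractionIso m (r ^ 2) + p.tractionNormal m (r ^ 2) * (sin θ ^ 2 * cos (2 * φ)) ∧
    (sphTraction (stress m p.field) r).θ θ φ
        = p.tractionTangential m (r ^ 2) * (sin θ * cos θ * cos (2 * φ)) ∧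
    (sphTraction (stress m p.field) r).φ θ φ
        = -(p.tractionTangential m (r ^ 2) * (sin θ * sin (2 * φ))) := by
  have h := stress_field m hp (x := sphPoint r θ φ) (by rwa [norm_sq_sphPoint])
  have hx : ∀ i, sphPoint r θ φ i = r * eR θ φ i := by
    intro i; fin_cases i <;> simp [sphPoint, eR]
  have hθ := sin_sq_add_cos_sq θ
  have hφ := sin_sq_add_cos_sq φ
  have hn : eR θ φ 0 ^ 2 + eR θ φ 1 ^ 2 + eR θ φ 2 ^ 2 = 1 := by
    simp [eR]; linear_combination (sin θ ^ 2) * hφ + hθ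
  have hr1 : eR θ φ 0 * eR θ φ 0 + eR θ φ 1 * eR θ φ 1 + eR θ φ 2 * eR θ φ 2 = 1 := by
    rw [← hn]; ring
  have hr2 : eR θ φ 0 * eR θ φ 0 - eR θ φ 1 * eR θ φ 1 = sin θ ^ 2 * cos (2 * φ) := by
    simp [eR]; rw [cos_two_mul']; ring
  have ht1 : eTheta θ φ 0 * eR θ φ 0 + eTheta θ φ 1 * eR θ φ 1 + eTheta θ φ 2 * eR θ φ 2 = 0 := by
    simp [eR, eTheta]; linear_combination (sin θ * cos θ) * hφ
  have ht2 : eTheta θ φ 0 * eR θ φ 0 - eTheta θ φ 1 * eR θ φ 1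
      = sin θ * cos θ * cos (2 * φ) := by
    simp [eR, eTheta]; rw [cos_two_mul']; ring
  have hp1 : ePhi φ 0 * eR θ φ 0 + ePhi φ 1 * eR θ φ 1 + ePhi φ 2 * eR θ φ 2 = 0 := by
    simp [eR, ePhi]; ring
  have hp2 : ePhi φ 0 * eR θ φ 0 - ePhi φ 1 * eR θ φ 1 = -(sin θ * sin (2 * φ)) := by
    simp [eR, ePhi]; rw [sin_two_mul]; ring
  simp only [sphTraction, h, sum_mul_fieldStress_mul p m _ hx hn, hr1, hr2, ht1, ht2, hp1, hp2,
    norm_sq_sphPoint, shearPoly_sphPoint, tractionIso, tractionNormal, tractionTangential]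
  refine ⟨?_, ?_, ?_⟩ <;> ring

end Profile

/-! ### The profiles of the two phases -/

/-- The profile of the displacements in the inhomogeneity. -/
def profileInh (mI : Material) (c : Coeffs) : Profile where
  α s := c.A1 / 2 - (7 - 4 * mI.ν) / (1 - 2 * mI.ν) * c.A2 / 2 * s
  α' _ := -((7 - 4 * mI.ν) / (1 - 2 * mI.ν) * c.A2 / 2)
  α'' _ := 0
  β _ := (7 - 10 * mI.ν) / (1 - 2 * mI.ν) * c.A2
  β' _ := 0
  β'' _ := 0
  δ _ := -c.A0
  δ' _ := 0
  δ'' _ := 0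

lemma hasDerivsOn_profileInh (mI : Material) (c : Coeffs) :
    (profileInh mI c).HasDerivsOn univ where
  α s _ := (((hasDerivAt_id s).const_mul _).const_sub _).congr_deriv (by simp [profileInh])
  α' s _ := hasDerivAt_const s _
  β s _ := hasDerivAt_const s _
  β' s _ := hasDerivAt_const s _
  δ s _ := hasDerivAt_const s _
  δ' s _ := hasDerivAt_const s _

/-- `s ↦ s ^ (-1/2)`. -/
def invSqrt (s : ℝ) : ℝ := (√s)⁻¹

lemma invSqrt_sq {r : ℝ} (hr : 0 ≤ r) : invSqrt (r ^ 2) = r⁻¹ := by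
  rw [invSqrt, sqrt_sq hr]

lemma mul_invSqrt_sq {s : ℝ} (hs : 0 < s) : s * invSqrt s ^ 2 = 1 := by
  rw [invSqrt, inv_pow, sq_sqrt hs.le, mul_inv_cancel₀ hs.ne']

lemma hasDerivAt_invSqrt {s : ℝ} (hs : 0 < s) :
    HasDerivAt invSqrt (-(invSqrt s ^ 3 / 2)) s := by
  have h0 : √s ≠ 0 := (sqrt_pos.2 hs).ne'
  refine ((hasDerivAt_sqrt hs.ne').inv h0).congr_deriv ?_
  rw [invSqrt]; field_simp

/-- Each derivative of s^(-k/2) raises k by two. Writing k = n + 1 avoids truncated subtraction in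
the power rule. -/
lemma hasDerivAt_mul_invSqrt_pow (a : ℝ) (n : ℕ) {s : ℝ} (hs : 0 < s) :
    HasDerivAt (fun s => a * invSqrt s ^ (n + 1)) (-((n + 1) / 2 * a) * invSqrt s ^ (n + 3)) s := by
  refine (((hasDerivAt_invSqrt hs).pow (n + 1)).const_mul a).congr_deriv ?_
  simp only [Nat.add_sub_cancel, Nat.cast_add, Nat.cast_one]
  ring

lemma contDiffAt_invSqrt {s : ℝ} (hs : 0 < s) : ContDiffAt ℝ ∞ invSqrt s :=
  (contDiffAt_sqrt hs.ne').inv (sqrt_pos.2 hs).ne'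

/-- The profile of the displacements in the matrix. -/
def profileMat (m : Material) (c : Coeffs) : Profile where
  α s := c.D1 / 2 + (c.D4 * invSqrt s ^ 3 + -c.D3 * invSqrt s ^ 5)
  α' s := -(3 / 2 * c.D4) * invSqrt s ^ 5 + 5 / 2 * c.D3 * invSqrt s ^ 7
  α'' s := 15 / 4 * c.D4 * invSqrt s ^ 7 + -(35 / 4 * c.D3) * invSqrt s ^ 9
  β s := 3 / (1 - 2 * m.ν) * c.D4 * invSqrt s ^ 5 + 5 * c.D3 * invSqrt s ^ 7
  β' s := -(15 / 2 / (1 - 2 * m.ν) * c.D4) * invSqrt s ^ 7 + -(35 / 2 * c.D3) * invSqrt s ^ 9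
  β'' s := 105 / 4 / (1 - 2 * m.ν) * c.D4 * invSqrt s ^ 9 + 315 / 4 * c.D3 * invSqrt s ^ 11
  δ s := -c.D0 * invSqrt s ^ 3
  δ' s := 3 / 2 * c.D0 * invSqrt s ^ 5
  δ'' s := -(15 / 4 * c.D0) * invSqrt s ^ 7

lemma hasDerivsOn_profileMat (m : Material) (c : Coeffs) :
    (profileMat m c).HasDerivsOn (Ioi 0) where
  α s hs := (((hasDerivAt_mul_invSqrt_pow _ 2 hs).add
    (hasDerivAt_mul_invSqrt_pow _ 4 hs)).const_add _).congr_deriv (by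
      simp only [profileMat]; push_cast; ring)
  α' s hs := ((hasDerivAt_mul_invSqrt_pow _ 4 hs).add
    (hasDerivAt_mul_invSqrt_pow _ 6 hs)).congr_deriv (by simp only [profileMat]; push_cast; ring)
  β s hs := ((hasDerivAt_mul_invSqrt_pow _ 4 hs).add
    (hasDerivAt_mul_invSqrt_pow _ 6 hs)).congr_deriv (by simp only [profileMat]; push_cast; ring)
  β' s hs := ((hasDerivAt_mul_invSqrt_pow _ 6 hs).add
    (hasDerivAt_mul_invSqrt_pow _ 8 hs)).congr_deriv (by simp only [profileMat]; push_cast; ring)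
  δ s hs := (hasDerivAt_mul_invSqrt_pow _ 2 hs).congr_deriv (by
    simp only [profileMat]; push_cast; ring)
  δ' s hs := (hasDerivAt_mul_invSqrt_pow _ 4 hs).congr_deriv (by
    simp only [profileMat]; push_cast; ring)

section Materials

variable {m : Material} (hm : m.Admissible)
include hm

lemma Material.Admissible.one_sub_pos : 0 < 1 - 2 * m.ν := by
  have := hm.2.2; linarith

/-- In terms of k = 1/(1 - 2ν) the identities below become polynomial in the elastic constants. -/
lemma Material.Admissible.lam_eq : m.lam = m.μ * ((1 - 2 * m.ν)⁻¹ - 1) := by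
  have h0 := hm.one_sub_pos.ne'
  rw [lam]; field_simp; ring

/-- The profiles were found by solving for the coefficients: α = Ut/(2r), β = (Ur - Ut)/r³ and δ =
u0/r, as functions of s = r². -/
lemma components_profileInh (c : Coeffs) (r : ℝ) : (profileInh m c).components r
    = shearShape (-(r * c.A0)) (UrInh m c r) (UtInh m c r) := by
  have h0 := hm.one_sub_pos.ne'
  simp only [Profile.components, profileInh, UrInh, UtInh]
  congr 1
  · ring
  · field_simp; ring
  · ring

lemma components_profileMat (c : Coeffs) {r : ℝ} (hr : 0 ≤ r) : (profileMat m c).components r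
    = shearShape (-(1 / r ^ 2 * c.D0)) (UrMat m c r) (UtMat c r) := by
  have h0 := hm.one_sub_pos.ne'
  simp only [Profile.components, profileMat, UrMat, UtMat, invSqrt_sq hr]
  -- At r = 0 both sides vanish because division by zero gives zero; the case is needed to identify
  -- the fields at the origin too.
  rcases hr.eq_or_lt with rfl | hr
  · simp
  have h5 : (5 - 4 * m.ν) / (1 - 2 * m.ν) = 2 + 3 / (1 - 2 * m.ν) := by
    rw [div_eq_iff h0, add_mul, div_mul_cancel₀ _ h0]; ring
  rw [h5]
  congr 1 <;> field_simp <;> ring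

lemma uInh_eq_field (c : Coeffs) : uInh m c = (profileInh m c).field :=
  Profile.sphField_eq_field _ fun r _ => (components_profileInh hm c r).symm

lemma uMat_eq_field (c : Coeffs) : uMat m c = (profileMat m c).field :=
  Profile.sphField_eq_field _ fun _ hr => (components_profileMat hm c hr).symm

lemma sphTrace_uInh (c : Coeffs) (r : ℝ) : sphTrace (uInh m c) r
    = shearShape (-(r * c.A0)) (UrInh m c r) (UtInh m c r) := by
  rw [uInh_eq_field hm, Profile.sphTrace_field, components_profileInh hm]

lemma sphTrace_uMat (c : Coeffs) {r : ℝ} (hr : 0 ≤ r) : sphTrace (uMat m c) r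
    = shearShape (-(1 / r ^ 2 * c.D0)) (UrMat m c r) (UtMat c r) := by
  rw [uMat_eq_field hm, Profile.sphTrace_field, components_profileMat hm c hr]

lemma balanced_profileInh (c : Coeffs) (s : ℝ) : (profileInh m c).Balanced m s := by
  have h0 := hm.one_sub_pos.ne'
  constructor <;> simp only [profileInh, Profile.iso₂, Material.lam] <;> field_simp <;> ring

lemma balanced_profileMat (c : Coeffs) {s : ℝ} (hs : 0 < s) : (profileMat m c).Balanced m s := by
  have hst := mul_invSqrt_sq hs
  have hl := hm.lam_eq
  constructor <;> simp only [profileMat, Profile.iso₂, hl, div_eq_mul_inv] <;>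
    generalize invSqrt s = t at * <;> generalize (1 - 2 * m.ν)⁻¹ = k
  · linear_combination (2 * m.μ * (k - 1) * (-(15 / 2 * k * c.D4) * t ^ 5 - 35 / 2 * c.D3 * t ^ 7)
      + 2 * m.μ * (2 * (15 / 4 * c.D4 * t ^ 5 - 35 / 4 * c.D3 * t ^ 7)
        + (-(15 / 2 * k * c.D4) * t ^ 5 - 35 / 2 * c.D3 * t ^ 7))) * hst
  · linear_combination ((2 * m.μ * (k - 1) + 4 * m.μ)
      * (105 / 4 * k * c.D4 * t ^ 7 + 315 / 4 * c.D3 * t ^ 9)) * hst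
  · linear_combination (-(2 * m.μ * (k - 1) + 4 * m.μ) * (15 / 4 * c.D0 * t ^ 5)) * hst

end Materials

/-! ### The far field -/

lemma shearStress_apply (a : ℝ) (i j : Fin 3) :
    shearStress a i j = a * (if i = j then shearSign i else 0) := by
  fin_cases i <;> fin_cases j <;> simp [shearStress, shearSign]

lemma shearStress_injective : Function.Injective shearStress := fun a b h => by
  simpa [shearStress] using congrFun (congrFun h 0) 0

/-- Once the contribution of D1 is split off, the rest is ‖x‖⁻³ times a polynomial in ‖x‖⁻¹ and the
direction cosines. That factor is bounded at infinity, though it need not converge. -/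
lemma fieldStress_profileMat {m : Material} (hm : m.Admissible) (c : Coeffs) {x : E3}
    (hx : 0 < ‖x‖) (i j : Fin 3) : (profileMat m c).fieldStress m x i j
      = shearStress (2 * m.μ * c.D1) i j + ‖x‖⁻¹ ^ 3 *
        ((((6 * m.μ * (1 - 2 * m.ν)⁻¹ - 6 * m.lam) * c.D4 + 10 * m.μ * c.D3 * ‖x‖⁻¹ ^ 2)
            * ((x 0 * ‖x‖⁻¹) ^ 2 - (x 1 * ‖x‖⁻¹) ^ 2) - 2 * m.μ * c.D0) * (if i = j then 1 else 0)
          + (6 * m.μ * ((1 - 2 * m.ν)⁻¹ - 1) * c.D4 + 20 * m.μ * c.D3 * ‖x‖⁻¹ ^ 2)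
            * (shearSign i + shearSign j) * ((x i * ‖x‖⁻¹) * (x j * ‖x‖⁻¹))
          + 4 * m.μ * (c.D4 - c.D3 * ‖x‖⁻¹ ^ 2) * (if i = j then shearSign i else 0)
          + (-(30 * m.μ * (1 - 2 * m.ν)⁻¹ * c.D4 + 70 * m.μ * c.D3 * ‖x‖⁻¹ ^ 2)
              * ((x 0 * ‖x‖⁻¹) ^ 2 - (x 1 * ‖x‖⁻¹) ^ 2) + 6 * m.μ * c.D0)
            * ((x i * ‖x‖⁻¹) * (x j * ‖x‖⁻¹))) := by
  have hst := mul_invSqrt_sq (pow_pos hx 2)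
  rw [shearStress_apply]
  simp only [Profile.fieldStress, profileMat, Profile.iso₂, Profile.iso₀, div_eq_mul_inv,
    shearPoly, hm.lam_eq]
  rw [invSqrt_sq (norm_nonneg x)] at *
  generalize ‖x‖⁻¹ = t at *
  generalize (1 - 2 * m.ν)⁻¹ = k
  generalize (if i = j then (1 : ℝ) else 0) = e
  linear_combination (2 * m.μ * (k - 1) * e * ((-(15 / 2 * k * c.D4) * t ^ 5 - 35 / 2 * c.D3 * t ^ 7)
    * (x 0 ^ 2 - x 1 ^ 2) + 3 / 2 * c.D0 * t ^ 3)) * hst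

lemma tendsto_stress_uMat {m : Material} (hm : m.Admissible) (c : Coeffs) :
    Tendsto (stress m (uMat m c)) (Bornology.cobounded E3) (𝓝 (shearStress (2 * m.μ * c.D1))) := by
  refine tendsto_pi_nhds.2 fun i => tendsto_pi_nhds.2 fun j => ?_
  have hpos : ∀ᶠ x : E3 in Bornology.cobounded E3, 0 < ‖x‖ :=
    tendsto_norm_cobounded_atTop.eventually (eventually_gt_atTop 0)
  have ht : Tendsto (fun x : E3 => ‖x‖⁻¹) (Bornology.cobounded E3) (𝓝 0) :=
    tendsto_inv_atTop_zero.comp tendsto_norm_cobounded_atTop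
  have hb : (fun x : E3 => ‖x‖⁻¹) =O[Bornology.cobounded E3] (fun _ => (1 : ℝ)) := ht.isBigO_one ℝ
  have hn : ∀ k : Fin 3,
      (fun x : E3 => x k * ‖x‖⁻¹) =O[Bornology.cobounded E3] (fun _ => (1 : ℝ)) := fun k => by
    refine Asymptotics.IsBigO.of_bound 1 (Eventually.of_forall fun x => ?_)
    rw [norm_mul, norm_inv, norm_norm, norm_one, mul_one, ← div_eq_mul_inv]
    exact div_le_one_of_le₀ (PiLp.norm_apply_le x k) (norm_nonneg x)
  have hc : ∀ a : ℝ, (fun _ : E3 => a) =O[Bornology.cobounded E3] (fun _ => (1 : ℝ)) := fun a =>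
    Asymptotics.isBigO_const_const a one_ne_zero _
  have add : ∀ {f g : E3 → ℝ}, f =O[Bornology.cobounded E3] (fun _ => (1 : ℝ)) →
      g =O[Bornology.cobounded E3] (fun _ => (1 : ℝ)) →
      (fun x => f x + g x) =O[Bornology.cobounded E3] (fun _ => (1 : ℝ)) := fun hf hg => hf.add hg
  have sub : ∀ {f g : E3 → ℝ}, f =O[Bornology.cobounded E3] (fun _ => (1 : ℝ)) →
      g =O[Bornology.cobounded E3] (fun _ => (1 : ℝ)) →
      (fun x => f x - g x) =O[Bornology.cobounded E3] (fun _ => (1 : ℝ)) := fun hf hg => hf.sub hg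
  have mul : ∀ {f g : E3 → ℝ}, f =O[Bornology.cobounded E3] (fun _ => (1 : ℝ)) →
      g =O[Bornology.cobounded E3] (fun _ => (1 : ℝ)) →
      (fun x => f x * g x) =O[Bornology.cobounded E3] (fun _ => (1 : ℝ)) := fun hf hg => by
    simpa using hf.mul hg
  have sq : ∀ {f : E3 → ℝ}, f =O[Bornology.cobounded E3] (fun _ => (1 : ℝ)) →
      (fun x => f x ^ 2) =O[Bornology.cobounded E3] (fun _ => (1 : ℝ)) := fun hf => by
    simpa using hf.pow 2
  have hP := sub (sq (hn 0)) (sq (hn 1))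
  have hij := mul (hn i) (hn j)
  have ht3 : Tendsto (fun x : E3 => ‖x‖⁻¹ ^ 3) (Bornology.cobounded E3) (𝓝 0) := by
    simpa using ht.pow 3
  -- The term repeats, summand by summand, the bracket of `fieldStress_profileMat`: an infinitesimal
  -- times a bounded function.
  have key := ((Asymptotics.isLittleO_one_iff ℝ).2 ht3).mul_isBigO
    (add (add (add
      (mul (sub (mul (add (hc ((6 * m.μ * (1 - 2 * m.ν)⁻¹ - 6 * m.lam) * c.D4))
        (mul (hc (10 * m.μ * c.D3)) (sq hb))) hP) (hc (2 * m.μ * c.D0))) (hc (if i = j then 1 else 0)))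
      (mul (mul (add (hc (6 * m.μ * ((1 - 2 * m.ν)⁻¹ - 1) * c.D4))
        (mul (hc (20 * m.μ * c.D3)) (sq hb))) (hc (shearSign i + shearSign j))) hij))
      (mul (mul (hc (4 * m.μ)) (sub (hc c.D4) (mul (hc c.D3) (sq hb))))
        (hc (if i = j then shearSign i else 0))))
      (mul (add (mul (add (hc (30 * m.μ * (1 - 2 * m.ν)⁻¹ * c.D4))
        (mul (hc (70 * m.μ * c.D3)) (sq hb))).neg_left hP) (hc (6 * m.μ * c.D0))) hij))
  rw [mul_one, Asymptotics.isLittleO_one_iff] at key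
  have h2 := key.const_add (shearStress (2 * m.μ * c.D1) i j)
  rw [add_zero] at h2
  refine h2.congr' (hpos.mono fun x hx => ?_)
  rw [uMat_eq_field hm]
  exact ((Profile.stress_field m (hasDerivsOn_profileMat m c) (pow_pos hx 2) i j).trans
    (fieldStress_profileMat hm c hx i j)).symm

/-! ### The problem as a system of equations for the profiles -/

/-- Y vanishes at θ = π/2, φ = π/4, which isolates u0; it is 1 at θ = π/2, φ = 0, which gives u0 +
Ur. The tangential amplitude is read off at θ = π/4, φ = 0. -/
lemma shearShape_inj {u0 Ur Ut u0' Ur' Ut' : ℝ} (h : ∀ θ ∈ Ioo 0 π, ∀ φ,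
    (shearShape u0 Ur Ut).r θ φ = (shearShape u0' Ur' Ut').r θ φ ∧
    (shearShape u0 Ur Ut).θ θ φ = (shearShape u0' Ur' Ut').θ θ φ) :
    u0 = u0' ∧ Ur = Ur' ∧ Ut = Ut' := by
  have hπ := pi_pos
  have e1 := (h (π / 2) ⟨by linarith, by linarith⟩ (π / 4)).1
  have e2 := (h (π / 2) ⟨by linarith, by linarith⟩ 0).1
  have e3 := (h (π / 4) ⟨by linarith, by linarith⟩ 0).2
  have h4 : 2 * (π / 4) = π / 2 := by ring
  simp only [shearShape, h4, mul_zero, cos_zero, cos_pi_div_two, sin_pi_div_two, one_pow, mul_one,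
    add_zero] at e1 e2 e3
  have hs : sin (π / 4) * cos (π / 4) ≠ 0 := by
    rw [sin_pi_div_four, cos_pi_div_four]; positivity
  refine ⟨e1, by linarith, mul_right_cancel₀ hs (by linarith)⟩

section Problem

variable {R σd : ℝ} {m mI : Material} (hR : 0 < R) (hm : m.Admissible) (hmI : mI.Admissible)
  (c : Coeffs) {jump : ℝ → SphComponents → SphComponents}
include hR hm hmI

/-- For a traction jump of the shape of simple shear, the fields solve the problem if and only if
the far-field amplitude, the displacements and the traction amplitudes match. -/
lemma isSolution_iff_profile {j0 jr jt : ℝ}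
    (hj : ∀ θ ∈ Ioo 0 π, ∀ φ : ℝ,
      (jump R ((profileInh mI c).components R)).r θ φ = j0 + jr * (sin θ ^ 2 * cos (2 * φ)) ∧
      (jump R ((profileInh mI c).components R)).θ θ φ = jt * (sin θ * cos θ * cos (2 * φ)) ∧
      (jump R ((profileInh mI c).components R)).φ θ φ = -(jt * (sin θ * sin (2 * φ)))) :
    IsSolution R m mI σd jump (uInh mI c) (uMat m c) ↔
      2 * m.μ * c.D1 = σd ∧
      (profileInh mI c).components R = (profileMat m c).components R ∧
      (profileInh mI c).tractionIso mI (R ^ 2) - (profileMat m c).tractionIso m (R ^ 2) = j0 ∧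
      (profileInh mI c).tractionNormal mI (R ^ 2) - (profileMat m c).tractionNormal m (R ^ 2)
        = jr ∧
      (profileInh mI c).tractionTangential mI (R ^ 2)
        - (profileMat m c).tractionTangential m (R ^ 2) = jt := by
  have hdI := hasDerivsOn_profileInh mI c
  have hdM := hasDerivsOn_profileMat m c
  have hTI := Profile.sphTraction_field mI hdI (r := R) (mem_univ _)
  have hTM := Profile.sphTraction_field m hdM (r := R) (pow_pos hR 2)
  rw [← uInh_eq_field hmI] at hTI
  rw [← uMat_eq_field hm] at hTM
  have hsI : sphTrace (uInh mI c) R = (profileInh mI c).components R := by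
    rw [uInh_eq_field hmI, Profile.sphTrace_field]
  have hsM : sphTrace (uMat m c) R = (profileMat m c).components R := by
    rw [uMat_eq_field hm, Profile.sphTrace_field]
  constructor
  · intro h
    refine ⟨shearStress_injective (tendsto_nhds_unique (tendsto_stress_uMat hm c) h.far_field),
      ?_, ?_⟩
    · rw [← hsI, ← hsM]
      have : ∀ θ φ, uInh mI c (sphPoint R θ φ) = uMat m c (sphPoint R θ φ) := fun θ φ =>
        h.continuity _ (norm_sphPoint hR.le θ φ)
      simp only [sphTrace, this]
    -- The traction jump is itself of shear shape, so `shearShape_inj` applies to tractions as well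
    -- as to displacements.
    · obtain ⟨h0, h1, h2⟩ := shearShape_inj (u0 := (profileInh mI c).tractionIso mI (R ^ 2)
          - (profileMat m c).tractionIso m (R ^ 2)) (u0' := j0)
        (Ur := (profileInh mI c).tractionNormal mI (R ^ 2)
          - (profileMat m c).tractionNormal m (R ^ 2)) (Ur' := jr)
        (Ut := (profileInh mI c).tractionTangential mI (R ^ 2)
          - (profileMat m c).tractionTangential m (R ^ 2)) (Ut' := jt) (by
        intro θ hθ φ
        have e1 := h.jump_r θ hθ φ
        have e2 := h.jump_θ θ hθ φ
        rw [hsI, (hTI θ φ).1, (hTM θ φ).1, (hj θ hθ φ).1] at e1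
        rw [hsI, (hTI θ φ).2.1, (hTM θ φ).2.1, (hj θ hθ φ).2.1] at e2
        simp only [shearShape]
        exact ⟨by linear_combination e1, by linear_combination e2⟩)
      exact ⟨h0, h1, h2⟩
  · rintro ⟨h1, h2, h3, h4, h5⟩
    constructor
    · intro x _
      rw [uInh_eq_field hmI]
      exact Profile.contDiffAt_field
        (contDiffAt_const.sub (contDiffAt_const.mul contDiffAt_id)) contDiffAt_const contDiffAt_const
    · intro x hx
      have ht := contDiffAt_invSqrt (pow_pos (hR.trans_le hx) 2)
      rw [uMat_eq_field hm]
      exact Profile.contDiffAt_field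
        (contDiffAt_const.add ((contDiffAt_const.mul (ht.pow 3)).add (contDiffAt_const.mul (ht.pow 5))))
        ((contDiffAt_const.mul (ht.pow 5)).add (contDiffAt_const.mul (ht.pow 7)))
        (contDiffAt_const.mul (ht.pow 3))
    · intro x _
      rw [uInh_eq_field hmI]
      exact Profile.equilibriumAt_field mI isOpen_univ hdI (mem_univ _) (balanced_profileInh hmI c _)
    · intro x hx
      have hx2 : 0 < ‖x‖ ^ 2 := pow_pos (hR.trans hx) 2
      rw [uMat_eq_field hm]
      exact Profile.equilibriumAt_field m isOpen_Ioi hdM hx2 (balanced_profileMat hm c hx2)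
    · intro x hx
      rw [uInh_eq_field hmI, uMat_eq_field hm, exists_sphPoint x, hx, Profile.field_sphPoint,
        Profile.field_sphPoint, h2]
    · intro θ hθ φ
      rw [hsI, (hTI θ φ).1, (hTM θ φ).1, (hj θ hθ φ).1, ← h3, ← h4]; ring
    · intro θ hθ φ
      rw [hsI, (hTI θ φ).2.1, (hTM θ φ).2.1, (hj θ hθ φ).2.1, ← h5]; ring
    · intro θ hθ φ
      rw [hsI, (hTI θ φ).2.2, (hTM θ φ).2.2, (hj θ hθ φ).2.2, ← h5]; ring
    · rw [← h1]; exact tendsto_stress_uMat hm c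

end Problem

/-! ### The explicit traction jumps -/

section Jump

variable {R r : ℝ} (S : Interface) (hR : 0 < R) (hr : 0 < r) (u0 Ur Ut : ℝ) {θ : ℝ}
  (hθ : θ ∈ Ioo 0 π) (φ : ℝ)
include hR hr hθ

lemma steigmannOgdenJump_eq_explicitJump :
    (steigmannOgdenJump S r (shearShape u0 Ur Ut)).r θ φ = (explicitJump S R r u0 Ur Ut).r θ φ ∧
    (steigmannOgdenJump S r (shearShape u0 Ur Ut)).θ θ φ = (explicitJump S R r u0 Ur Ut).θ θ φ ∧
    (steigmannOgdenJump S r (shearShape u0 Ur Ut)).φ θ φ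
      = (explicitJump S R r u0 Ur Ut).φ θ φ := by
  have hs := (sin_pos_of_mem_Ioo hθ).ne'
  rw [steigmannOgdenJump_shearShape_r S _ _ _ hr.ne' _ _ hs,
    steigmannOgdenJump_shearShape_θ S _ _ _ hr.ne' _ _ hs,
    steigmannOgdenJump_shearShape_φ S _ _ _ hr.ne' _ _ hs,
    gurtinMurdochJump_shearShape_r S _ _ _ hr.ne' _ _ hs,
    gurtinMurdochJump_shearShape_θ S _ _ _ hr.ne' _ _ hs,
    gurtinMurdochJump_shearShape_φ S _ _ _ hr.ne' _ _ hs]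
  simp only [explicitJump, Interface.gam]
  refine ⟨?_, ?_, ?_⟩
  all_goals field_simp
  all_goals ring

lemma steigmannOgdenJump_eq_gurtinMurdochJump (hS : S.gam R = 0) :
    (steigmannOgdenJump S r (shearShape u0 Ur Ut)).r θ φ
      = (gurtinMurdochJump S r (shearShape u0 Ur Ut)).r θ φ ∧
    (steigmannOgdenJump S r (shearShape u0 Ur Ut)).θ θ φ
      = (gurtinMurdochJump S r (shearShape u0 Ur Ut)).θ θ φ ∧
    (steigmannOgdenJump S r (shearShape u0 Ur Ut)).φ θ φ
      = (gurtinMurdochJump S r (shearShape u0 Ur Ut)).φ θ φ := by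
  have hs := (sin_pos_of_mem_Ioo hθ).ne'
  have h0 : 5 * S.χ₀ + 3 * S.ζ₀ = 0 :=
    (div_eq_zero_iff.1 hS).resolve_right (pow_pos hR 3).ne'
  rw [steigmannOgdenJump_shearShape_r S _ _ _ hr.ne' _ _ hs,
    steigmannOgdenJump_shearShape_θ S _ _ _ hr.ne' _ _ hs,
    steigmannOgdenJump_shearShape_φ S _ _ _ hr.ne' _ _ hs]
  refine ⟨?_, ?_, ?_⟩
  · linear_combination (-(6 / r ^ 4 * (2 * Ur - Ut) * sin θ ^ 2 * cos (2 * φ))) * h0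
  · linear_combination (1 / r ^ 4 * (2 * Ur - Ut) * sin (2 * θ) * cos (2 * φ)) * h0
  · linear_combination (-(2 / r ^ 4 * (2 * Ur - Ut) * sin θ * sin (2 * φ))) * h0

end Jump

lemma IsSolution.congr_jump {R σd : ℝ} {m mI : Material} {uI uM : E3 → E3}
    {jump jump' : ℝ → SphComponents → SphComponents}
    (h : ∀ θ ∈ Ioo 0 π, ∀ φ : ℝ,
      (jump R (sphTrace uI R)).r θ φ = (jump' R (sphTrace uI R)).r θ φ ∧
      (jump R (sphTrace uI R)).θ θ φ = (jump' R (sphTrace uI R)).θ θ φ ∧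
      (jump R (sphTrace uI R)).φ θ φ = (jump' R (sphTrace uI R)).φ θ φ)
    (hs : IsSolution R m mI σd jump uI uM) : IsSolution R m mI σd jump' uI uM :=
  { hs with
    jump_r := fun θ hθ φ => (hs.jump_r θ hθ φ).trans (h θ hθ φ).1
    jump_θ := fun θ hθ φ => (hs.jump_θ θ hθ φ).trans (h θ hθ φ).2.1
    jump_φ := fun θ hθ φ => (hs.jump_φ θ hθ φ).trans (h θ hθ φ).2.2 }

/-! ### Linear algebra -/

/-- With k = 1/(1 - 2ν) one has νk = (k - 1)/2. This turns every fraction in Poisson's ratio into an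
affine expression in k. -/
lemma Material.Admissible.affine_div {m : Material} (hm : m.Admissible) (a b : ℝ) :
    (a + b * m.ν) / (1 - 2 * m.ν) = a * (1 - 2 * m.ν)⁻¹ + b * (((1 - 2 * m.ν)⁻¹ - 1) / 2) := by
  have h := mul_inv_cancel₀ hm.one_sub_pos.ne'
  rw [div_eq_mul_inv]
  linear_combination (-(b / 2)) * h

/-- Reduces the equivalence of two scalar equations to a single identity, once the proportionality
factor k is known. -/
lemma eq_iff_of_sub_eq_mul {a b c d k : ℝ} (hk : k ≠ 0) (h : a - b = k * (c - d)) :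
    a = b ↔ c = d := by
  rw [← sub_eq_zero, h, mul_eq_zero, or_iff_right hk, sub_eq_zero]

/-! ### The problem and the two linear systems -/

section Algebra

variable {R σd : ℝ} {m mI : Material} (S : Interface) (hR : 0 < R) (hm : m.Admissible)
  (hmI : mI.Admissible) (c : Coeffs)
include hR hm hmI

lemma isSolution_steigmannOgden_iff :
    IsSolution R m mI σd (steigmannOgdenJump S) (uInh mI c) (uMat m c) ↔
      c.D1 = σd / (2 * m.μ) ∧ c.D0 = R ^ 3 * c.A0 ∧
        isoDenom R m mI S * c.A0 = 2 * S.σ₀ / R ∧ ShearSystem R m mI S c := by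
  have hμ : m.μ ≠ 0 := hm.1.ne'
  have hμI : mI.μ ≠ 0 := hmI.1.ne'
  have hR0 := hR.ne'
  rw [isSolution_iff_profile hR hm hmI c
    (j0 := -(2 * S.σ₀ / R) - 2 * (2 * S.μ₀ + 2 * S.lam₀ + S.σ₀) * (-(R * c.A0)) / R ^ 2)
    (jr := 1 / R ^ 2 * (6 * (S.lam₀ + S.μ₀ + S.σ₀) * UtInh mI c R
        - 4 * (S.μ₀ + S.lam₀ + 2 * S.σ₀) * UrInh mI c R)
      - 6 * S.gam R * (R ^ 3 / R ^ 4) * (2 * UrInh mI c R - UtInh mI c R))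
    (jt := 2 * (1 / R ^ 2 * (-(3 * S.lam₀ + 5 * S.μ₀ + S.σ₀) * UtInh mI c R
        + 2 * (S.μ₀ + S.lam₀ + S.σ₀) * UrInh mI c R)
      + S.gam R * (R ^ 3 / R ^ 4) * (2 * UrInh mI c R - UtInh mI c R)))]
  swap
  · intro θ hθ φ
    obtain ⟨h1, h2, h3⟩ := steigmannOgdenJump_eq_explicitJump S hR hR (-(R * c.A0))
      (UrInh mI c R) (UtInh mI c R) hθ φ
    rw [components_profileInh hmI, h1, h2, h3]
    simp only [explicitJump]
    refine ⟨by ring, ?_, by ring⟩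
    -- The explicit jump uses sin 2θ while the traction amplitude multiplies sin θ cos θ, hence the
    -- factor 2 in `jt`.
    rw [sin_two_mul]; ring
  have hcomp : (profileInh mI c).components R = (profileMat m c).components R ↔
      -(R * c.A0) = -(1 / R ^ 2 * c.D0) ∧ UrInh mI c R = UrMat m c R ∧
        UtInh mI c R = UtMat c R := by
    rw [components_profileInh hmI, components_profileMat hm c hR.le]
    refine ⟨fun h => shearShape_inj fun θ _ φ => by rw [h]; exact ⟨rfl, rfl⟩, ?_⟩
    rintro ⟨h1, h2, h3⟩
    rw [h1, h2, h3]
  rw [hcomp, ShearSystem]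
  have a1 := hmI.affine_div 7 (-4)
  have a2 := hmI.affine_div 0 6
  have a3 := hmI.affine_div 7 (-10)
  have a4 := hm.affine_div 5 (-4)
  have a5 := hmI.affine_div 1 1
  rw [neg_mul, ← sub_eq_add_neg] at a1 a3 a4
  rw [zero_add] at a2
  rw [one_mul] at a5
  have b5 : mI.bulk = mI.μ * (3 * (1 - 2 * mI.ν)⁻¹ - 1) / 3 := by
    rw [Material.bulk, mul_div_assoc, a5]; ring
  have e0 : c.D1 = σd / (2 * m.μ) ↔ 2 * m.μ * c.D1 = σd := by
    rw [eq_div_iff (by positivity), mul_comm]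
  have e1 : c.D0 = R ^ 3 * c.A0 ↔ -(R * c.A0) = -(1 / R ^ 2 * c.D0) :=
    eq_iff_of_sub_eq_mul (pow_pos hR 2).ne' (by field_simp; ring)
  have e2 : c.A1 * R - 3 * (mI.lam / mI.μ) * c.A2 * R ^ 3 - 3 * c.D3 / R ^ 4
      - (3 * m.lam + 5 * m.μ) / m.μ * (c.D4 / R ^ 2) = c.D1 * R ↔ UrInh mI c R = UrMat m c R := by
    refine eq_iff_of_sub_eq_mul one_ne_zero ?_
    rw [UrInh, UrMat, hm.lam_eq, hmI.lam_eq, a2, a4]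
    generalize (1 - 2 * mI.ν)⁻¹ = k
    generalize (1 - 2 * m.ν)⁻¹ = l
    field_simp; ring
  have e3 : c.A1 * R - (5 * mI.lam + 7 * mI.μ) / mI.μ * c.A2 * R ^ 3 + 2 * c.D3 / R ^ 4
      - 2 * (c.D4 / R ^ 2) = c.D1 * R ↔ UtInh mI c R = UtMat c R := by
    refine eq_iff_of_sub_eq_mul one_ne_zero ?_
    rw [UtInh, UtMat, hmI.lam_eq, a1]
    generalize (1 - 2 * mI.ν)⁻¹ = k
    field_simp; ring
  have e4 : C31 R mI S * c.A1 * R + C32 R mI S * c.A2 * R ^ 3 - 24 * m.μ * (c.D3 / R ^ 4)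
      - (18 * m.lam + 20 * m.μ) * (c.D4 / R ^ 2) = -2 * m.μ * c.D1 * R ↔
      (profileInh mI c).tractionNormal mI (R ^ 2) - (profileMat m c).tractionNormal m (R ^ 2)
        = 1 / R ^ 2 * (6 * (S.lam₀ + S.μ₀ + S.σ₀) * UtInh mI c R
        - 4 * (S.μ₀ + S.lam₀ + 2 * S.σ₀) * UrInh mI c R)
      - 6 * S.gam R * (R ^ 3 / R ^ 4) * (2 * UrInh mI c R - UtInh mI c R) := by
    refine eq_iff_of_sub_eq_mul (neg_ne_zero.2 hR0) ?_
    simp only [C31, C32, Profile.tractionNormal, Profile.iso₂, profileInh, profileMat, UrInh, UtInh,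
      invSqrt_sq hR.le, hm.lam_eq, hmI.lam_eq, a1, a2, a3, div_eq_mul_inv _ (1 - 2 * m.ν)]
    generalize S.gam R = g
    generalize (1 - 2 * mI.ν)⁻¹ = k
    generalize (1 - 2 * m.ν)⁻¹ = l
    field_simp; ring
  have e5 : C41 R mI S * c.A1 * R + C42 R mI S * c.A2 * R ^ 3 + 8 * m.μ * (c.D3 / R ^ 4)
      + (3 * m.lam + 2 * m.μ) * (c.D4 / R ^ 2) = -m.μ * c.D1 * R ↔
      (profileInh mI c).tractionTangential mI (R ^ 2)
        - (profileMat m c).tractionTangential m (R ^ 2)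
      = 2 * (1 / R ^ 2 * (-(3 * S.lam₀ + 5 * S.μ₀ + S.σ₀) * UtInh mI c R
        + 2 * (S.μ₀ + S.lam₀ + S.σ₀) * UrInh mI c R)
      + S.gam R * (R ^ 3 / R ^ 4) * (2 * UrInh mI c R - UtInh mI c R)) := by
    refine eq_iff_of_sub_eq_mul (k := -(R / 2)) (by simpa using hR0) ?_
    simp only [C41, C42, Profile.tractionTangential, profileInh, profileMat, UrInh, UtInh,
      invSqrt_sq hR.le, hm.lam_eq, hmI.lam_eq, a1, a2, a3, div_eq_mul_inv _ (1 - 2 * m.ν)]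
    generalize S.gam R = g
    generalize (1 - 2 * mI.ν)⁻¹ = k
    generalize (1 - 2 * m.ν)⁻¹ = l
    field_simp; ring
  -- The isotropic tractions are -3K_I A0 inside and 4μD0/R³ outside; they combine into one equation
  -- for A0 only after continuity has eliminated D0.
  have e6 : c.D0 = R ^ 3 * c.A0 → (isoDenom R m mI S * c.A0 = 2 * S.σ₀ / R ↔
      (profileInh mI c).tractionIso mI (R ^ 2) - (profileMat m c).tractionIso m (R ^ 2)
        = -(2 * S.σ₀ / R) - 2 * (2 * S.μ₀ + 2 * S.lam₀ + S.σ₀) * (-(R * c.A0)) / R ^ 2) := by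
    intro h
    refine eq_iff_of_sub_eq_mul (k := -1) (by norm_num) ?_
    simp only [isoDenom, b5, Interface.eta, Profile.tractionIso, Profile.iso₀, profileInh,
      profileMat, invSqrt_sq hR.le, hm.lam_eq, hmI.lam_eq, h]
    generalize (1 - 2 * mI.ν)⁻¹ = k
    generalize (1 - 2 * m.ν)⁻¹ = l
    field_simp; ring
  rw [← e0, ← e1, ← e2, ← e3, ← e4, ← e5]
  constructor
  · rintro ⟨h0, ⟨h1, h2, h3⟩, h4, h5, h6⟩
    exact ⟨h0, h1, (e6 h1).2 h4, h2, h3, h5, h6⟩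
  · rintro ⟨h0, h1, h4, h2, h3, h5, h6⟩
    exact ⟨h0, ⟨h1, h2, h3⟩, (e6 h1).1 h4, h5, h6⟩

/-- Equation by equation, the systems differ by nonzero factors and order, the isotropic traction
equation after substituting D0 = R³A0. The hypothesis removes γ from `C31`, `C32`, `C41`, `C42`,
since `gmF1` and `gmF2` contain no bending term. -/
lemma gurtinMurdochSystem_iff (hS : S.gam R = 0) :
    GurtinMurdochSystem R m mI S c ↔
      c.D0 = R ^ 3 * c.A0 ∧ isoDenom R m mI S * c.A0 = 2 * S.σ₀ / R ∧ ShearSystem R m mI S c := by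
  have hμ : m.μ ≠ 0 := hm.1.ne'
  have hμI : mI.μ ≠ 0 := hmI.1.ne'
  have hR0 := hR.ne'
  have a1 := hmI.affine_div 7 (-4)
  have a2 := hmI.affine_div 0 6
  have a3 := hmI.affine_div 7 2
  have a4 := hm.affine_div 5 (-4)
  have a5 := hmI.affine_div 1 1
  have a6 := hm.affine_div 1 1
  have a7 := hm.affine_div (-5) 1
  have a8 := hmI.affine_div 0 3
  rw [neg_mul, ← sub_eq_add_neg] at a1 a4
  rw [zero_add] at a2 a8
  rw [one_mul] at a5 a6 a7
  rw [add_comm, ← sub_eq_add_neg] at a7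
  have b5 : mI.bulk = mI.μ * (3 * (1 - 2 * mI.ν)⁻¹ - 1) / 3 := by
    rw [Material.bulk, mul_div_assoc, a5]; ring
  rw [GurtinMurdochSystem, ShearSystem]
  have e1 : 1 / R ^ 3 * c.D0 = c.A0 ↔ c.D0 = R ^ 3 * c.A0 :=
    eq_iff_of_sub_eq_mul (k := 1 / R ^ 3) (by positivity) (by field_simp)
  have e2 : c.D1 - 2 / R ^ 5 * c.D3 + 2 / R ^ 3 * c.D4
      = c.A1 - R ^ 2 * ((7 - 4 * mI.ν) / (1 - 2 * mI.ν)) * c.A2 ↔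
      c.A1 * R - (5 * mI.lam + 7 * mI.μ) / mI.μ * c.A2 * R ^ 3 + 2 * c.D3 / R ^ 4
      - 2 * (c.D4 / R ^ 2) = c.D1 * R := by
    refine eq_iff_of_sub_eq_mul (k := -(1 / R)) (by simpa using hR0) ?_
    rw [hmI.lam_eq, a1]
    generalize (1 - 2 * mI.ν)⁻¹ = k
    field_simp; ring
  have e3 : c.D1 + 3 / R ^ 5 * c.D3 + 1 / R ^ 3 * ((5 - 4 * m.ν) / (1 - 2 * m.ν)) * c.D4
      = c.A1 - R ^ 2 * (6 * mI.ν / (1 - 2 * mI.ν)) * c.A2 ↔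
      c.A1 * R - 3 * (mI.lam / mI.μ) * c.A2 * R ^ 3 - 3 * c.D3 / R ^ 4
      - (3 * m.lam + 5 * m.μ) / m.μ * (c.D4 / R ^ 2) = c.D1 * R := by
    refine eq_iff_of_sub_eq_mul (k := -(1 / R)) (by simpa using hR0) ?_
    rw [hm.lam_eq, hmI.lam_eq, a2, a4]
    generalize (1 - 2 * mI.ν)⁻¹ = k
    generalize (1 - 2 * m.ν)⁻¹ = l
    field_simp; ring
  have e4 : c.D0 = R ^ 3 * c.A0 → (2 / R ^ 3 * c.D0
      = -(mI.μ / m.μ * ((1 + mI.ν) / (1 - 2 * mI.ν)) * c.A0) - gmF0 R m S c ↔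
      isoDenom R m mI S * c.A0 = 2 * S.σ₀ / R) := by
    intro h
    refine eq_iff_of_sub_eq_mul (k := 1 / (2 * m.μ)) (by positivity) ?_
    rw [h, isoDenom, b5, gmF0, a5, Interface.eta]
    generalize (1 - 2 * mI.ν)⁻¹ = k
    field_simp; ring
  have e5 : c.D1 + 2 / R ^ 3 * (4 / R ^ 2 * c.D3 + (1 + m.ν) / (1 - 2 * m.ν) * c.D4)
      = mI.μ / m.μ * (c.A1 - R ^ 2 * ((7 + 2 * mI.ν) / (1 - 2 * mI.ν)) * c.A2)
        - 6 * gmF1 R m mI S c ↔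
      C41 R mI S * c.A1 * R + C42 R mI S * c.A2 * R ^ 3 + 8 * m.μ * (c.D3 / R ^ 4)
      + (3 * m.lam + 2 * m.μ) * (c.D4 / R ^ 2) = -m.μ * c.D1 * R := by
    refine eq_iff_of_sub_eq_mul (k := 1 / (m.μ * R)) (by positivity) ?_
    rw [gmF1, C41, C42, hS, a1, a2, a3, a6, hm.lam_eq, hmI.lam_eq]
    generalize (1 - 2 * mI.ν)⁻¹ = k
    generalize (1 - 2 * m.ν)⁻¹ = l
    field_simp; ring
  have e6 : c.D1 + 2 / R ^ 3 * (-(6 / R ^ 2) * c.D3 + (m.ν - 5) / (1 - 2 * m.ν) * c.D4)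
      = mI.μ / m.μ * (c.A1 + R ^ 2 * (3 * mI.ν / (1 - 2 * mI.ν)) * c.A2)
        - 3 * gmF2 R m mI S c ↔
      C31 R mI S * c.A1 * R + C32 R mI S * c.A2 * R ^ 3 - 24 * m.μ * (c.D3 / R ^ 4)
      - (18 * m.lam + 20 * m.μ) * (c.D4 / R ^ 2) = -2 * m.μ * c.D1 * R := by
    refine eq_iff_of_sub_eq_mul (k := 1 / (2 * m.μ * R)) (by positivity) ?_
    rw [gmF2, C31, C32, hS, a1, a2, a7, a8, hm.lam_eq, hmI.lam_eq]
    generalize (1 - 2 * mI.ν)⁻¹ = k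
    generalize (1 - 2 * m.ν)⁻¹ = l
    field_simp; ring
  rw [e1, e2, e3, e5, e6]
  constructor
  · rintro ⟨h1, h2, h3, h4, h5, h6⟩
    exact ⟨h1, (e4 h1).1 h4, h3, h2, h6, h5⟩
  · rintro ⟨h1, h4, h3, h2, h6, h5⟩
    exact ⟨h1, h2, h3, (e4 h1).2 h4, h5, h6⟩

end Algebra

/-- Elimination of the two matrix amplitudes from the (scaled) system for the shear
coefficients. -/
lemma shear_elimination {μ lam n l c31 c32 c41 c42 : ℝ} (hμ : μ ≠ 0) (hN : 9 * lam + 14 * μ ≠ 0)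
    (a b p q D : ℝ) :
    (a - l * b - 3 * p - (3 * lam + 5 * μ) / μ * q = D ∧ a - n * b + 2 * p - 2 * q = D ∧
      c31 * a + c32 * b - 24 * μ * p - (18 * lam + 20 * μ) * q = -2 * μ * D ∧
      c41 * a + c42 * b + 8 * μ * p + (3 * lam + 2 * μ) * q = -μ * D) ↔
    (1 - ((3 * lam + 10 * μ) * c31 + (18 * lam + 44 * μ) * c41) / (4 * μ * (9 * lam + 14 * μ))) * a
      + (-(((3 * lam + 10 * μ) * c32 + (18 * lam + 44 * μ) * c42)
        / (4 * μ * (9 * lam + 14 * μ))) - n) * b = 15 * (lam + 2 * μ) / (9 * lam + 14 * μ) * D ∧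
    (1 - ((15 * lam + 34 * μ) * c31 + 6 * (3 * lam + 10 * μ) * c41)
        / (8 * μ * (9 * lam + 14 * μ))) * a
      + (-l - ((15 * lam + 34 * μ) * c32 + 6 * (3 * lam + 10 * μ) * c42)
        / (8 * μ * (9 * lam + 14 * μ))) * b = 15 * (lam + 2 * μ) / (9 * lam + 14 * μ) * D ∧
    p = -(a * ((3 * lam + 2 * μ) * c31 + (18 * lam + 20 * μ) * c41)
      + b * ((3 * lam + 2 * μ) * c32 + (18 * lam + 20 * μ) * c42)
      + 24 * μ * (μ + lam) * D) / (8 * μ * (9 * lam + 14 * μ)) ∧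
    q = (a * (c31 + 3 * c41) + b * (c32 + 3 * c42) + 5 * μ * D) / (9 * lam + 14 * μ) := by
  set P := -(a * ((3 * lam + 2 * μ) * c31 + (18 * lam + 20 * μ) * c41)
      + b * ((3 * lam + 2 * μ) * c32 + (18 * lam + 20 * μ) * c42)
      + 24 * μ * (μ + lam) * D) / (8 * μ * (9 * lam + 14 * μ)) with hP
  set Q := (a * (c31 + 3 * c41) + b * (c32 + 3 * c42) + 5 * μ * D) / (9 * lam + 14 * μ) with hQ
  -- The traction equations, as a system for p and q, have determinant 8μ(9λ + 14μ) ≠ 0.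
  have hpq : (c31 * a + c32 * b - 24 * μ * p - (18 * lam + 20 * μ) * q = -2 * μ * D ∧
      c41 * a + c42 * b + 8 * μ * p + (3 * lam + 2 * μ) * q = -μ * D) ↔ p = P ∧ q = Q := by
    rw [hP, hQ, eq_div_iff (by positivity), eq_div_iff hN]
    constructor
    · rintro ⟨h3, h4⟩
      exact ⟨by linear_combination (3 * lam + 2 * μ) * h3 + (18 * lam + 20 * μ) * h4,
        by linear_combination -h3 - 3 * h4⟩
    · rintro ⟨hp, hq⟩
      exact ⟨mul_left_cancel₀ hN (by linear_combination (-(18 * lam + 20 * μ)) * hq - 3 * hp),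
        mul_left_cancel₀ hN (by linear_combination (3 * lam + 2 * μ) * hq + hp)⟩
  rw [hpq]
  -- Substituting P and Q into tangential continuity gives the first row of the reduced system;
  -- normal continuity gives the second. Both right-hand sides turn out to be the same multiple of
  -- D.
  have id1 : (1 - ((3 * lam + 10 * μ) * c31 + (18 * lam + 44 * μ) * c41)
        / (4 * μ * (9 * lam + 14 * μ))) * a
      + (-(((3 * lam + 10 * μ) * c32 + (18 * lam + 44 * μ) * c42)
        / (4 * μ * (9 * lam + 14 * μ))) - n) * b - 15 * (lam + 2 * μ) / (9 * lam + 14 * μ) * D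
      = a - n * b + 2 * P - 2 * Q - D := by
    rw [hP, hQ]
    clear_value P Q
    clear hpq hP hQ
    -- Trading λ for N = 9λ + 14μ makes the denominator an atom that can be cleared.
    generalize hN' : 9 * lam + 14 * μ = N at *
    obtain rfl : lam = (N - 14 * μ) / 9 := by linarith
    field_simp; ring
  have id2 : (1 - ((15 * lam + 34 * μ) * c31 + 6 * (3 * lam + 10 * μ) * c41)
        / (8 * μ * (9 * lam + 14 * μ))) * a
      + (-l - ((15 * lam + 34 * μ) * c32 + 6 * (3 * lam + 10 * μ) * c42)
        / (8 * μ * (9 * lam + 14 * μ))) * b - 15 * (lam + 2 * μ) / (9 * lam + 14 * μ) * D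
      = a - l * b - 3 * P - (3 * lam + 5 * μ) / μ * Q - D := by
    rw [hP, hQ]
    clear_value P Q
    clear hpq hP hQ
    generalize hN' : 9 * lam + 14 * μ = N at *
    obtain rfl : lam = (N - 14 * μ) / 9 := by linarith
    field_simp; ring
  constructor
  · rintro ⟨h1, h2, rfl, rfl⟩
    exact ⟨by linear_combination id1 + h2, by linear_combination id2 + h1, rfl, rfl⟩
  · rintro ⟨h1, h2, rfl, rfl⟩
    exact ⟨by linear_combination h2 - id2, by linear_combination h1 - id1, rfl, rfl⟩

/-- Cramer's rule; because the right-hand sides coincide, the numerators are differences of matrix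
entries times f. -/
lemma cramer_two {e11 e12 e21 e22 : ℝ} (h : e11 * e22 - e12 * e21 ≠ 0) (a b f : ℝ) :
    (e11 * a + e12 * b = f ∧ e21 * a + e22 * b = f) ↔
      a = (e22 - e12) * f / (e11 * e22 - e12 * e21) ∧
      b = (e11 - e21) * f / (e11 * e22 - e12 * e21) := by
  rw [eq_div_iff h, eq_div_iff h]
  constructor
  · rintro ⟨h1, h2⟩
    exact ⟨by linear_combination e22 * h1 - e12 * h2, by linear_combination e11 * h2 - e21 * h1⟩
  · rintro ⟨h1, h2⟩
    exact ⟨mul_left_cancel₀ h (by linear_combination e11 * h1 + e12 * h2),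
      mul_left_cancel₀ h (by linear_combination e21 * h1 + e22 * h2)⟩

lemma Material.Admissible.nine_lam_add_pos {m : Material} (hm : m.Admissible) :
    0 < 9 * m.lam + 14 * m.μ := by
  have h1 := hm.one_sub_pos
  have hμ := hm.1
  have hν := hm.2.1
  have : 9 * m.lam + 14 * m.μ = m.μ * (14 - 10 * m.ν) / (1 - 2 * m.ν) := by
    rw [lam]; field_simp; ring
  rw [this]
  exact div_pos (mul_pos hμ (by linarith [hm.2.2])) h1

/-- Dividing by R and taking A1, R²A2, D3/R⁵, D4/R³ as unknowns removes the explicit powers of R, so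
that `shear_elimination` and `cramer_two` apply. -/
lemma shearSystem_iff_ratio {R : ℝ} {m mI : Material} (S : Interface) (hR : 0 < R)
    (hm : m.Admissible) (hE : detE R m mI S ≠ 0) (c : Coeffs) :
    ShearSystem R m mI S c ↔
      c.A1 = ratioA1 R m mI S * c.D1 ∧ c.A2 = ratioA2 R m mI S * c.D1 ∧
      c.D3 = ratioD3 R m mI S * c.D1 ∧ c.D4 = ratioD4 R m mI S * c.D1 := by
  have hN := hm.nine_lam_add_pos.ne'
  have hμ : m.μ ≠ 0 := hm.1.ne'
  have hR0 := hR.ne'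
  have hS : ShearSystem R m mI S c ↔
      (c.A1 - 3 * mI.lam / mI.μ * (R ^ 2 * c.A2) - 3 * (c.D3 / R ^ 5)
          - (3 * m.lam + 5 * m.μ) / m.μ * (c.D4 / R ^ 3) = c.D1 ∧
        c.A1 - (5 * mI.lam + 7 * mI.μ) / mI.μ * (R ^ 2 * c.A2) + 2 * (c.D3 / R ^ 5)
          - 2 * (c.D4 / R ^ 3) = c.D1 ∧
        C31 R mI S * c.A1 + C32 R mI S * (R ^ 2 * c.A2) - 24 * m.μ * (c.D3 / R ^ 5)
          - (18 * m.lam + 20 * m.μ) * (c.D4 / R ^ 3) = -2 * m.μ * c.D1 ∧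
        C41 R mI S * c.A1 + C42 R mI S * (R ^ 2 * c.A2) + 8 * m.μ * (c.D3 / R ^ 5)
          + (3 * m.lam + 2 * m.μ) * (c.D4 / R ^ 3) = -m.μ * c.D1) := by
    refine and_congr (eq_iff_of_sub_eq_mul hR0 ?_) (and_congr (eq_iff_of_sub_eq_mul hR0 ?_)
      (and_congr (eq_iff_of_sub_eq_mul hR0 ?_) (eq_iff_of_sub_eq_mul hR0 ?_)))
    all_goals
      have h4 : R * (c.D3 / R ^ 5) = c.D3 / R ^ 4 := by field_simp
      have h2 : R * (c.D4 / R ^ 3) = c.D4 / R ^ 2 := by field_simp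
    · linear_combination 3 * h4 + (3 * m.lam + 5 * m.μ) / m.μ * h2
    · linear_combination (-2) * h4 + 2 * h2
    · linear_combination (24 * m.μ) * h4 + (18 * m.lam + 20 * m.μ) * h2
    · linear_combination (-(8 * m.μ)) * h4 - (3 * m.lam + 2 * m.μ) * h2
  -- The coefficients produced by the elimination are those of `E11`, ..., `E22` and `coeffF` by
  -- definition.
  have h : _ ↔ E11 R m mI S * c.A1 + E12 R m mI S * (R ^ 2 * c.A2) = coeffF m * c.D1 ∧
      E21 R m mI S * c.A1 + E22 R m mI S * (R ^ 2 * c.A2) = coeffF m * c.D1 ∧ _ ∧ _ :=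
    shear_elimination hμ hN c.A1 (R ^ 2 * c.A2) (c.D3 / R ^ 5) (c.D4 / R ^ 3) c.D1
  have hc := cramer_two hE c.A1 (R ^ 2 * c.A2) (coeffF m * c.D1)
  have h1 : c.A1 = (E22 R m mI S - E12 R m mI S) * (coeffF m * c.D1) / detE R m mI S ↔
      c.A1 = ratioA1 R m mI S * c.D1 := by
    rw [ratioA1, iff_iff_eq]; congr 1; ring
  have h2 : R ^ 2 * c.A2 = (E11 R m mI S - E21 R m mI S) * (coeffF m * c.D1) / detE R m mI S ↔
      c.A2 = ratioA2 R m mI S * c.D1 := by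
    refine eq_iff_of_sub_eq_mul (pow_pos hR 2).ne' ?_
    rw [ratioA2]; field_simp
  rw [detE] at h1 h2
  rw [hS, h, ← and_assoc, hc, h1, h2, and_assoc]
  refine and_congr_right fun hA1 => and_congr_right fun hA2 => ?_
  rw [hA1, hA2, ratioD3, ratioD4, div_eq_iff (pow_pos hR 5).ne', div_eq_iff (pow_pos hR 3).ne']
  generalize ratioA1 R m mI S = a
  generalize ratioA2 R m mI S = b
  rw [iff_iff_eq]
  congr 2 <;> ring

/-! ### The solution of the problem in closed form -/

section Closed

variable {R σd : ℝ} {m mI : Material} (S : Interface) (hR : 0 < R) (hm : m.Admissible)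
  (hmI : mI.Admissible)
include hR hm hmI

lemma isSolution_iff_eq_closedCoeffs (hI : isoDenom R m mI S ≠ 0) (hE : detE R m mI S ≠ 0)
    (c : Coeffs) : IsSolution R m mI σd (steigmannOgdenJump S) (uInh mI c) (uMat m c) ↔
      c = closedCoeffs R m mI S σd := by
  rw [isSolution_steigmannOgden_iff S hR hm hmI, shearSystem_iff_ratio S hR hm hE, Coeffs.ext_iff]
  have hA : isoDenom R m mI S * c.A0 = 2 * S.σ₀ / R ↔ c.A0 = 2 * S.σ₀ / R / isoDenom R m mI S := by
    rw [eq_div_iff hI, mul_comm]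
  rw [hA]
  simp only [closedCoeffs]
  constructor
  · rintro ⟨h1, h2, h3, h4, h5, h6, h7⟩
    rw [h3] at h2
    rw [h1] at h4 h5 h6 h7
    exact ⟨h3, h4, h5, h2, h1, h6, h7⟩
  · rintro ⟨h3, h4, h5, h2, h1, h6, h7⟩
    rw [h3, h1]
    exact ⟨rfl, h2, rfl, h4, h5, h6, h7⟩

omit hm in
-- Only 5χ₀ + 3ζ₀ = 0 is needed, not χ₀ = ζ₀ = 0: the bending terms cancel for the trace of these
-- particular fields.
lemma isSolution_steigmannOgden_iff_gurtinMurdoch (hS : S.gam R = 0) (c : Coeffs) :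
    IsSolution R m mI σd (steigmannOgdenJump S) (uInh mI c) (uMat m c) ↔
      IsSolution R m mI σd (gurtinMurdochJump S) (uInh mI c) (uMat m c) := by
  have h : ∀ θ ∈ Ioo 0 π, ∀ φ : ℝ, _ := fun θ hθ φ =>
    steigmannOgdenJump_eq_gurtinMurdochJump S hR hR (-(R * c.A0)) (UrInh mI c R) (UtInh mI c R)
      hθ φ hS
  rw [← sphTrace_uInh hmI] at h
  exact ⟨IsSolution.congr_jump h, IsSolution.congr_jump fun θ hθ φ =>
    ⟨(h θ hθ φ).1.symm, (h θ hθ φ).2.1.symm, (h θ hθ φ).2.2.symm⟩⟩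

end Closed

end SphericalInhomogeneity

end

/-! ### The main theorem -/

theorem mainTheorem2 (R σd : ℝ) (m mI : Material) (S : Interface)
    (hR : 0 < R) (hm : m.Admissible) (hmI : mI.Admissible) :
    -- the fields have the spherical components of the representations
    (∀ (c : Coeffs) (r : ℝ), 0 < r → ∀ θ ∈ Icc 0 π, ∀ φ : ℝ,
      ((sphTrace (uInh mI c) r).r θ φ
          = -(r * c.A0) + UrInh mI c r * sin θ ^ 2 * cos (2 * φ) ∧
        (sphTrace (uInh mI c) r).θ θ φ = UtInh mI c r * sin θ * cos θ * cos (2 * φ) ∧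
        (sphTrace (uInh mI c) r).φ θ φ = -(UtInh mI c r * sin θ * sin (2 * φ))) ∧
      ((sphTrace (uMat m c) r).r θ φ
          = -(1 / r ^ 2 * c.D0) + UrMat m c r * sin θ ^ 2 * cos (2 * φ) ∧
        (sphTrace (uMat m c) r).θ θ φ = UtMat c r * sin θ * cos θ * cos (2 * φ) ∧
        (sphTrace (uMat m c) r).φ θ φ = -(UtMat c r * sin θ * sin (2 * φ)))) ∧
    -- substitution into the Steigmann–Ogden conditions gives the explicit jumps
    (∀ r u0 Ur Ut : ℝ, 0 < r → ∀ θ ∈ Ioo 0 π, ∀ φ : ℝ,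
      (steigmannOgdenJump S r (shearShape u0 Ur Ut)).r θ φ
        = (explicitJump S R r u0 Ur Ut).r θ φ ∧
      (steigmannOgdenJump S r (shearShape u0 Ur Ut)).θ θ φ
        = (explicitJump S R r u0 Ur Ut).θ θ φ ∧
      (steigmannOgdenJump S r (shearShape u0 Ur Ut)).φ θ φ
        = (explicitJump S R r u0 Ur Ut).φ θ φ) ∧
    -- the tractions of any solution of this form jump accordingly
    (∀ c : Coeffs,
      IsSolution R m mI σd (steigmannOgdenJump S) (uInh mI c) (uMat m c) →
      ∀ θ ∈ Ioo 0 π, ∀ φ : ℝ,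
        (sphTraction (stress mI (uInh mI c)) R).r θ φ
            - (sphTraction (stress m (uMat m c)) R).r θ φ
          = (explicitJump S R R (-(R * c.A0)) (UrInh mI c R) (UtInh mI c R)).r θ φ ∧
        (sphTraction (stress mI (uInh mI c)) R).θ θ φ
            - (sphTraction (stress m (uMat m c)) R).θ θ φ
          = (explicitJump S R R (-(R * c.A0)) (UrInh mI c R) (UtInh mI c R)).θ θ φ ∧
        (sphTraction (stress mI (uInh mI c)) R).φ θ φ
            - (sphTraction (stress m (uMat m c)) R).φ θ φ
          = (explicitJump S R R (-(R * c.A0)) (UrInh mI c R) (UtInh mI c R)).φ θ φ) ∧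
    -- the problem is equivalent to a linear system for the coefficients
    (∀ c : Coeffs,
      IsSolution R m mI σd (steigmannOgdenJump S) (uInh mI c) (uMat m c) ↔
        c.D1 = σd / (2 * m.μ) ∧ c.D0 = R ^ 3 * c.A0 ∧
        isoDenom R m mI S * c.A0 = 2 * S.σ₀ / R ∧ ShearSystem R m mI S c) ∧
    -- closed form of the four shear coefficients
    (detE R m mI S ≠ 0 → ∀ c : Coeffs,
      ShearSystem R m mI S c ↔
        c.A1 = ratioA1 R m mI S * c.D1 ∧ c.A2 = ratioA2 R m mI S * c.D1 ∧
        c.D3 = ratioD3 R m mI S * c.D1 ∧ c.D4 = ratioD4 R m mI S * c.D1) ∧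
    -- the solution of the problem, and its modified Christensen–Lo form
    (isoDenom R m mI S ≠ 0 → detE R m mI S ≠ 0 →
      (∀ c : Coeffs,
        IsSolution R m mI σd (steigmannOgdenJump S) (uInh mI c) (uMat m c) ↔
          c = closedCoeffs R m mI S σd) ∧
      ∀ r : ℝ, 0 < r → ∀ θ ∈ Icc 0 π, ∀ φ : ℝ,
        (sphTrace (uInh mI (closedCoeffs R m mI S σd)) r).r θ φ
          = UrInh mI (closedCoeffs R m mI S σd) r * sin θ ^ 2 * cos (2 * φ)
            + -(2 / isoDenom R m mI S) * S.σ₀ * (r / R) ∧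
        (sphTrace (uMat m (closedCoeffs R m mI S σd)) r).r θ φ
          = UrMat m (closedCoeffs R m mI S σd) r * sin θ ^ 2 * cos (2 * φ)
            + -(2 / isoDenom R m mI S) * S.σ₀ * (r / R) ^ (-2 : ℤ)) ∧
    -- reduction to the Gurtin–Murdoch model
    (S.gam R = 0 → ∀ c : Coeffs,
      (IsSolution R m mI σd (steigmannOgdenJump S) (uInh mI c) (uMat m c) ↔
        IsSolution R m mI σd (gurtinMurdochJump S) (uInh mI c) (uMat m c)) ∧
      (IsSolution R m mI σd (gurtinMurdochJump S) (uInh mI c) (uMat m c) ↔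
        c.D1 = σd / (2 * m.μ) ∧ GurtinMurdochSystem R m mI S c) ∧
      (GurtinMurdochSystem R m mI S c ↔
        c.D0 = R ^ 3 * c.A0 ∧ isoDenom R m mI S * c.A0 = 2 * S.σ₀ / R ∧
        ShearSystem R m mI S c) ∧
      (isoDenom R m mI S ≠ 0 → detE R m mI S ≠ 0 →
        (IsSolution R m mI σd (gurtinMurdochJump S) (uInh mI c) (uMat m c) ↔
          c = closedCoeffs R m mI S σd))) := by
  refine ⟨?_, ?_, ?_, fun c => isSolution_steigmannOgden_iff S hR hm hmI c,
    fun hE c => shearSystem_iff_ratio S hR hm hE c, ?_, ?_⟩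
  · intro c r hr θ _ φ
    rw [sphTrace_uInh hmI, sphTrace_uMat hm c hr.le]
    exact ⟨⟨rfl, rfl, rfl⟩, rfl, rfl, rfl⟩
  · intro r u0 Ur Ut hr θ hθ φ
    exact steigmannOgdenJump_eq_explicitJump S hR hr u0 Ur Ut hθ φ
  · intro c h θ hθ φ
    rw [h.jump_r θ hθ φ, h.jump_θ θ hθ φ, h.jump_φ θ hθ φ, sphTrace_uInh hmI]
    exact steigmannOgdenJump_eq_explicitJump S hR hR _ _ _ hθ φ
  · intro hI hE
    refine ⟨isSolution_iff_eq_closedCoeffs S hR hm hmI hI hE, fun r hr θ _ φ => ?_⟩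
    rw [sphTrace_uInh hmI, sphTrace_uMat hm _ hr.le]
    have hr0 := hr.ne'
    have hR0 := hR.ne'
    simp only [shearShape]
    constructor
    · rw [add_comm]
      congr 1
      simp only [closedCoeffs]
      ring
    · rw [add_comm]
      congr 1
      -- Here D0 = R³A0, so -D0/r² = -(RA0)(R/r)², which is the exponent -2.
      simp only [closedCoeffs, zpow_neg]
      norm_cast
      field_simp
  · intro hS c
    have h1 := isSolution_steigmannOgden_iff_gurtinMurdoch (σd := σd) (m := m) S hR hmI hS c
    have h2 := gurtinMurdochSystem_iff S hR hm hmI c hS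
    refine ⟨h1, ?_, h2, fun hI hE => ?_⟩
    · rw [← h1, h2, isSolution_steigmannOgden_iff S hR hm hmI]
    · rw [← h1, isSolution_iff_eq_closedCoeffs S hR hm hmI hI hE]
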